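/- Let $n\ge 1$. Let $H=-\Delta+|x|^2$ be the Hermite operator on $\mathbb{R}^n$ and, for $k=0,1,2,\dots$ and $f\in L^2(\mathbb{R}^n)$ (complex valued), let $P_kf$ be the orthogonal projection of $f$ onto the eigenspace of $H$ in $L^2(\mathbb{R}^n)$ with eigenvalue $2k+n$. Let $L_k^{n-1}(t)=\sum_{i=0}^k(-1)^i\binom{k+n-1}{k-i}\frac{t^i}{i!}$ be the Laguerre polynomials of type $n-1$ and define the Laguerre functions on $\mathbb{C}^n$ by $$\varphi_k^{n-1}(z)=L_k^{n-1}\!\left(\tfrac12 z^2\right)e^{-\frac14 z^2},\qquad z^2=\sum_{j=1}^n z_j^2,$$ so that $\varphi_k^{n-1}(2iy)=L_k^{n-1}(-2|y|^2)e^{|y|^2}>0$ for $y\in\mathbb{R}^n$. **Theorem (Beurling–Hermite).** There is no nonzero $f\in L^2(\mathbb{R}^n)$ for which $$\sum_{k=0}^\infty\int_{\mathbb{R}^n}|f(y)|\,\|P_kf\|_2\,\sqrt{\varphi_k^{n-1}(2iy)}\;dy<\infty .$$ -/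

import Mathlib

open MeasureTheory
open scoped SchwartzMap

noncomputable section

/-- The Euclidean space `ℝⁿ`. -/
abbrev RSpace (n : ℕ) : Type := EuclideanSpace ℝ (Fin n)

/-- The Hilbert space `L²(ℝⁿ)` of complex-valued functions, with respect to Lebesgue measure. -/
abbrev L2Space (n : ℕ) : Type := Lp ℂ 2 (volume : Measure (RSpace n))

/-- The Hermite operator `H = -Δ + |x|²`, acting on tempered distributions. -/
def hermiteOperator (n : ℕ) : 𝓢'(RSpace n, ℂ) →L[ℂ] 𝓢'(RSpace n, ℂ) :=
  -LineDeriv.laplacianCLM ℂ (RSpace n) 𝓢'(RSpace n, ℂ) +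
    TemperedDistribution.smulLeftCLM ℂ (fun x : RSpace n => ((‖x‖ ^ 2 : ℝ) : ℂ))

/-- The operator is given by duality: `⟨H u, ψ⟩ = ⟨u, χ⟩` as soon as the Schwartz function `χ`
is `-Δψ + |x|² ψ`. -/
theorem hermiteOperator_apply (n : ℕ) (u : 𝓢'(RSpace n, ℂ)) (ψ χ : 𝓢(RSpace n, ℂ))
    (hχ : ∀ x, χ x = -(Laplacian.laplacian ψ) x + ((‖x‖ ^ 2 : ℝ) : ℂ) * ψ x) :
    hermiteOperator n u ψ = u χ := by
  have hg : (fun x : RSpace n => ((‖x‖ ^ 2 : ℝ) : ℂ)).HasTemperateGrowth := by fun_prop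
  have h : χ = -Laplacian.laplacian ψ +
      SchwartzMap.smulLeftCLM ℂ (fun x : RSpace n => ((‖x‖ ^ 2 : ℝ) : ℂ)) ψ := by
    ext x
    rw [hχ, add_apply, SchwartzMap.smulLeftCLM_apply_apply hg]
    simp
  rw [h, map_add, map_neg, hermiteOperator, add_apply,
    neg_apply, TemperedDistribution.laplacianCLM_apply]
  change -(Laplacian.laplacian u) ψ + _ = _
  rw [TemperedDistribution.laplacian_apply_apply]
  rfl

/-- The eigenspace in `L²(ℝⁿ)` of the Hermite operator with eigenvalue `2k + n`, i.e. the space of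
all `g ∈ L²(ℝⁿ)` with `H g = (2k + n) g` in the sense of tempered distributions. -/
def hermiteEigenspace (n k : ℕ) : Submodule ℂ (L2Space n) :=
  ((hermiteOperator n - (2 * k + n : ℂ) • ContinuousLinearMap.id ℂ 𝓢'(RSpace n, ℂ)) ∘L
    Lp.toTemperedDistributionCLM ℂ (volume : Measure (RSpace n)) 2).ker

theorem mem_hermiteEigenspace_iff (n k : ℕ) (g : L2Space n) :
    g ∈ hermiteEigenspace n k ↔
      hermiteOperator n (Lp.toTemperedDistribution g) =
        (2 * k + n : ℂ) • Lp.toTemperedDistribution g := by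
  simp [hermiteEigenspace, sub_eq_zero]

instance hermiteEigenspace_completeSpace (n k : ℕ) : CompleteSpace (hermiteEigenspace n k) :=
  IsClosed.completeSpace_coe (hs := ContinuousLinearMap.isClosed_ker
    ((hermiteOperator n - (2 * k + n : ℂ) • ContinuousLinearMap.id ℂ 𝓢'(RSpace n, ℂ)) ∘L
      Lp.toTemperedDistributionCLM ℂ (volume : Measure (RSpace n)) 2))

/-- The Hermite projection `P_k`: the orthogonal projection of `L²(ℝⁿ)` onto the eigenspace of the
Hermite operator with eigenvalue `2k + n`. -/
def hermiteProj (n k : ℕ) : L2Space n →L[ℂ] L2Space n :=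
  (hermiteEigenspace n k).starProjection

/-- The Laguerre polynomial `L_k^a(t) = ∑_{i ≤ k} (-1)^i C(k + a, k - i) t^i / i!` of type
`a ∈ ℕ`, as a function of a complex variable. -/
def laguerre (a k : ℕ) (t : ℂ) : ℂ :=
  ∑ i ∈ Finset.range (k + 1), (-1) ^ i * ((k + a).choose (k - i) : ℂ) * t ^ i / (i.factorial : ℂ)

/-- The Laguerre function `φ_k^a(z) = L_k^a(z² / 2) exp(-z² / 4)` on `ℂⁿ`, where
`z² = ∑ j, z_j²`. -/
def laguerreFun {n : ℕ} (a k : ℕ) (z : Fin n → ℂ) : ℂ :=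
  laguerre a k ((1 / 2) * ∑ j, z j ^ 2) * Complex.exp (-(1 / 4) * ∑ j, z j ^ 2)

/-- The point `2iy ∈ ℂⁿ` for `y ∈ ℝⁿ`. -/
def twoI {n : ℕ} (y : RSpace n) : Fin n → ℂ := fun j => 2 * Complex.I * (y j : ℂ)

/-- At points `2iy` with `y` real, the Laguerre function takes a real nonnegative value, so that
nothing is lost by taking its real part. -/
theorem laguerreFun_twoI {n : ℕ} (a k : ℕ) (y : RSpace n) :
    0 ≤ (laguerreFun a k (twoI y)).re ∧ (laguerreFun a k (twoI y)).im = 0 := by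
  have hs : ∑ j, twoI y j ^ 2 = ((-(4 * ‖y‖ ^ 2) : ℝ) : ℂ) := by
    rw [EuclideanSpace.real_norm_sq_eq, Finset.mul_sum, ← Finset.sum_neg_distrib]
    push_cast
    refine Finset.sum_congr rfl fun j _ => ?_
    simp only [twoI, mul_pow, Complex.I_sq]
    ring
  have h : laguerreFun a k (twoI y) =
      (((∑ i ∈ Finset.range (k + 1),
        ((k + a).choose (k - i) : ℝ) * (2 * ‖y‖ ^ 2) ^ i / (i.factorial : ℝ)) *
          Real.exp (‖y‖ ^ 2) : ℝ) : ℂ) := by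
    rw [laguerreFun, hs, laguerre]
    push_cast
    congr 1
    · refine Finset.sum_congr rfl fun i _ => ?_
      rw [show (1 / 2 : ℂ) * (-(4 * (‖y‖ : ℂ) ^ 2)) = (-1) * (2 * (‖y‖ : ℂ) ^ 2) by ring, mul_pow,
        show ∀ b c : ℂ, (-1) ^ i * b * ((-1) ^ i * c) = ((-1) * (-1)) ^ i * (b * c) by
          intro b c; rw [mul_pow]; ring]
      simp
    · congr 1
      ring
  rw [h]
  refine ⟨?_, Complex.ofReal_im _⟩
  rw [Complex.ofReal_re]
  positivity

end

/-!
For a unit vector `ω`, the function `G(τ) = ∫ f(x) exp(-|x|²/2) exp(2τ⟨ω, x⟩ - τ²) dx` is the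
Bargmann transform of `f` restricted to a complex line. By the generating function of the Hermite
polynomials, its `k`-th Taylor coefficient pairs `f` with `He_k(√2⟨ω, x⟩) exp(-|x|²/2)`, an
eigenfunction of `H` with eigenvalue `2k + n`. Hence `|G(τ)| ≤ m(|τ|)` for a majorant
`m(r) = π^(n/4) ∑ ‖P_k f‖ (√2 r)^k / √(k!)` which does not depend on `ω`. For real `r`, on the other
hand, `|G(r)|` is at most the value at `rω` of the convolution of `|f| exp(|x|²/2)` with
`exp(-|x|²)`.

The two bounds meet in the Laguerre weight: `∫ (√2|u|)^k exp(-|u - x|²) du` is at most a constant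
times `√(k! L_k^{n-1}(-2|x|²))`, because its square is at most a Gaussian moment of order `2k` in
`2n` dimensions, and the generating function of those moments is that of Laguerre polynomials. In
polar coordinates the hypothesis then gives `∫ |G(r)| m(|r|) dr < ∞` over the real line for almost
every `ω`. By Hörmander's proof of Beurling's theorem, the primitive of `G(z) G(iz)` is bounded on
the coordinate axes, thus by Phragmén–Lindelöf everywhere, so `G = 0`. The values of `G` on the
imaginary axis determine the Fourier transform of `f(x) exp(-|x|²/2)`, so `f = 0`.
-/

noncomputable section

section Beurling

open Filter Topology Set Complex
open scoped Real ENNReal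

/-- Growth of order at most two and finite type, the growth condition under which the
Phragmén–Lindelöf principle holds in every sector of opening less than `π / 2`. -/
def HasGaussianGrowth (G : ℂ → ℂ) : Prop :=
  ∃ C B : ℝ, 0 ≤ B ∧ ∀ z, ‖G z‖ ≤ C * Real.exp (B * ‖z‖ ^ 2)

theorem HasGaussianGrowth.mul {F G : ℂ → ℂ} (hF : HasGaussianGrowth F)
    (hG : HasGaussianGrowth G) : HasGaussianGrowth fun z => F z * G z := by
  obtain ⟨C, B, hB, hF⟩ := hF
  obtain ⟨C', B', hB', hG⟩ := hG
  refine ⟨C * C', B + B', add_nonneg hB hB', fun z => ?_⟩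
  rw [norm_mul, add_mul, Real.exp_add, mul_mul_mul_comm]
  exact mul_le_mul (hF z) (hG z) (norm_nonneg _) ((norm_nonneg _).trans (hF z))

theorem HasGaussianGrowth.comp_const_mul {G : ℂ → ℂ} (hG : HasGaussianGrowth G) (c : ℂ) :
    HasGaussianGrowth fun z => G (c * z) := by
  obtain ⟨C, B, hB, hG⟩ := hG
  refine ⟨C, B * ‖c‖ ^ 2, by positivity, fun z => (hG _).trans_eq ?_⟩
  rw [norm_mul, mul_pow, mul_assoc]

theorem norm_le_of_norm_le_on_sector_boundary {Φ : ℂ → ℂ} (hd : Differentiable ℂ Φ)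
    (hΦ : HasGaussianGrowth Φ) {a b K : ℝ} (hab : b - a < π / 2)
    (ha : ∀ r : ℝ, 0 < r → ‖Φ (r * exp (a * I))‖ ≤ K)
    (hb : ∀ r : ℝ, 0 < r → ‖Φ (r * exp (b * I))‖ ≤ K)
    {θ r : ℝ} (haθ : a ≤ θ) (hθb : θ ≤ b) (hr : 0 < r) : ‖Φ (r * exp (θ * I))‖ ≤ K := by
  obtain ⟨C, B, hB, hΦ⟩ := hΦ
  have hC : 0 ≤ C := by simpa using (norm_nonneg _).trans (hΦ 0)
  rcases haθ.eq_or_lt with rfl | haθ'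
  · exact ha r hr
  have hexp (z : ℂ) : exp z = (Real.exp z.re : ℝ) * exp (z.im * I) := by
    rw [ofReal_exp, ← exp_add, re_add_im]
  have hpolar : exp ((Real.log r : ℝ) + θ * I) = r * exp (θ * I) := by
    rw [exp_add, ← ofReal_exp, Real.exp_log hr]
  rw [← hpolar]
  -- The exponential maps a strip of width less than `π / 2` onto the sector.
  refine PhragmenLindelof.horizontal_strip (a := a) (b := b) (f := Φ ∘ exp)
    (hd.comp differentiable_exp).diffContOnCl ⟨2, ?_, B, ?_⟩ ?_ ?_ (by simpa) (by simpa)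
  · rw [lt_div_iff₀ (by linarith)]
    linarith
  · refine Asymptotics.IsBigO.of_bound C (Eventually.of_forall fun z => (hΦ _).trans ?_)
    rw [Real.norm_of_nonneg (Real.exp_nonneg _), norm_exp, ← Real.exp_nat_mul, Nat.cast_ofNat]
    gcongr
    exact le_abs_self z.re
  · intro z hz
    rw [Function.comp_apply, hexp, hz]
    exact ha _ (Real.exp_pos _)
  · intro z hz
    rw [Function.comp_apply, hexp, hz]
    exact hb _ (Real.exp_pos _)

/-- The primitive of `H` which vanishes at the origin, as an integral over the segment `[0, z]`. -/
def radialPrimitive (H : ℂ → ℂ) (z : ℂ) : ℂ := ∫ t in (0 : ℝ)..1, z * H (t * z)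

theorem hasDerivAt_radialPrimitive {H : ℂ → ℂ} (hH : Differentiable ℂ H) (z : ℂ) :
    HasDerivAt (radialPrimitive H) (H z) z := by
  obtain ⟨g, hg0, hg⟩ := hH.isExactOn_univ.with_val_at 0 0
  have hray (w : ℂ) (t : ℝ) : HasDerivAt (fun t : ℝ => g (t * w)) (w * H (t * w)) t := by
    have : HasDerivAt (fun t : ℝ => (t : ℂ) * w) w t := by
      simpa using (ofRealCLM.hasDerivAt (x := t)).mul_const w
    simpa only [mul_comm, Function.comp_def] using (hg (t * w) trivial).comp t this
  have : radialPrimitive H = g := by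
    funext w
    have := intervalIntegral.integral_eq_sub_of_hasDerivAt (a := 0) (b := 1)
      (fun t _ => hray w t)
      ((continuous_const.mul (hH.continuous.comp (by fun_prop))).intervalIntegrable _ _)
    simpa only [radialPrimitive, ofReal_one, one_mul, ofReal_zero, zero_mul, hg0, sub_zero]
      using this
  rw [this]
  exact hg z trivial

theorem differentiable_radialPrimitive {H : ℂ → ℂ} (hH : Differentiable ℂ H) :
    Differentiable ℂ (radialPrimitive H) :=
  fun z => (hasDerivAt_radialPrimitive hH z).differentiableAt

theorem radialPrimitive_const_mul (H : ℂ → ℂ) (c z : ℂ) :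
    radialPrimitive H (c * z) = c * radialPrimitive (fun w => H (c * w)) z := by
  simp only [radialPrimitive, ← intervalIntegral.integral_const_mul, mul_assoc, mul_left_comm]

theorem norm_radialPrimitive_le {H : ℂ → ℂ} {M : ℝ} {z : ℂ} (h : ∀ w, ‖w‖ ≤ ‖z‖ → ‖H w‖ ≤ M) :
    ‖radialPrimitive H z‖ ≤ ‖z‖ * M := by
  refine (intervalIntegral.norm_integral_le_of_norm_le_const (C := ‖z‖ * M) fun t ht => ?_).trans
    (by simp)
  rw [uIoc_of_le zero_le_one] at ht
  rw [norm_mul]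
  gcongr
  refine h _ ?_
  rw [norm_mul, norm_real, Real.norm_of_nonneg ht.1.le]
  exact mul_le_of_le_one_left (norm_nonneg _) ht.2

theorem HasGaussianGrowth.radialPrimitive {H : ℂ → ℂ} (hH : HasGaussianGrowth H) :
    HasGaussianGrowth (radialPrimitive H) := by
  obtain ⟨C, B, hB, hH⟩ := hH
  have hC : 0 ≤ C := by simpa using (norm_nonneg _).trans (hH 0)
  refine ⟨C, B + 1, by positivity, fun z => ?_⟩
  have hz : ‖z‖ ≤ Real.exp (‖z‖ ^ 2) := by
    nlinarith [Real.add_one_le_exp (‖z‖ ^ 2), sq_nonneg (‖z‖ - 1)]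
  calc ‖_root_.radialPrimitive H z‖
      ≤ ‖z‖ * (C * Real.exp (B * ‖z‖ ^ 2)) :=
        norm_radialPrimitive_le fun w hw => (hH w).trans (by gcongr)
    _ ≤ Real.exp (‖z‖ ^ 2) * (C * Real.exp (B * ‖z‖ ^ 2)) := by gcongr
    _ = C * Real.exp ((B + 1) * ‖z‖ ^ 2) := by rw [add_mul, Real.exp_add, one_mul]; ring

theorem norm_radialPrimitive_ray_le {H : ℂ → ℂ} {e : ℂ} (he : ‖e‖ = 1) {K : ℝ≥0∞} (hK : K ≠ ⊤)
    (h : ∫⁻ t in Ioi (0 : ℝ), ‖H (t * e)‖ₑ ≤ K) {r : ℝ} (hr : 0 < r) :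
    ‖radialPrimitive H (r * e)‖ ≤ K.toReal := by
  have hsubst : radialPrimitive H (r * e) = ∫ t in (0 : ℝ)..r, e * H (t * e) := by
    have := intervalIntegral.smul_integral_comp_mul_right (a := 0) (b := 1)
      (fun t : ℝ => e * H (t * e)) r
    rw [zero_mul, one_mul] at this
    rw [← this, radialPrimitive, ← intervalIntegral.integral_smul]
    refine intervalIntegral.integral_congr fun t _ => ?_
    simp only [real_smul, ofReal_mul, mul_assoc]
  have henorm (t : ℝ) : ‖e * H (t * e)‖ₑ = ‖H (t * e)‖ₑ := by simp [← ofReal_norm, he]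
  rw [← toReal_enorm]
  refine ENNReal.toReal_mono hK ?_
  calc ‖radialPrimitive H (r * e)‖ₑ
      ≤ ∫⁻ t in Ioc 0 r, ‖e * H (t * e)‖ₑ := by
        rw [hsubst, intervalIntegral.integral_of_le hr.le]
        exact enorm_integral_le_lintegral_enorm _
    _ ≤ ∫⁻ t in Ioi (0 : ℝ), ‖H (t * e)‖ₑ := by
        simp only [henorm]
        exact lintegral_mono_set Ioc_subset_Ioi_self
    _ ≤ K := h

theorem continuous_radialPrimitive_param {X : Type*} [TopologicalSpace X] {H : X → ℂ → ℂ}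
    (hH : Continuous (Function.uncurry H)) (z : ℂ) :
    Continuous fun x => radialPrimitive (H x) z := by
  unfold radialPrimitive
  apply intervalIntegral.continuous_parametric_intervalIntegral_of_continuous'
  have : Continuous fun p : X × ℝ => Function.uncurry H (p.1, p.2 * z) := hH.comp (by fun_prop)
  exact continuous_const.mul this

theorem norm_ofReal_mul_of_norm_eq_one {e : ℂ} (he : ‖e‖ = 1) {t : ℝ} (ht : 0 ≤ t) :
    ‖t * e‖ = t := by
  rw [norm_mul, he, mul_one, norm_real, Real.norm_of_nonneg ht]

section Quadrant

variable {A B : ℂ → ℂ} {m : ℝ → ℝ≥0∞} {K : ℝ≥0∞}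

theorem norm_radialPrimitive_mul_rotated_le (hA : Differentiable ℂ A) (hB : Differentiable ℂ B)
    (hAg : HasGaussianGrowth A) (hBg : HasGaussianGrowth B) (hAm : ∀ z, ‖A z‖ₑ ≤ m ‖z‖)
    (hBm : ∀ z, ‖B z‖ₑ ≤ m ‖z‖) (hK : K ≠ ⊤) (hAK : ∫⁻ r in Ioi (0 : ℝ), ‖A r‖ₑ * m r ≤ K)
    (hBK : ∫⁻ r in Ioi (0 : ℝ), ‖B (r * I)‖ₑ * m r ≤ K) {α : ℝ} (hα : 0 < α) {z : ℂ}
    (hz : z ≠ 0) (hz0 : 0 ≤ arg z) (hzα : arg z ≤ π / 2 - α) :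
    ‖radialPrimitive (fun w => A w * B (exp (α * I) * w)) z‖ ≤ K.toReal := by
  have hrot : exp (α * I) * exp ((π / 2 - α : ℝ) * I) = I := by
    rw [← exp_add, ← add_mul, ← ofReal_add, add_sub_cancel, ofReal_div, ofReal_ofNat,
      exp_pi_div_two_mul_I]
  have hd : Differentiable ℂ fun w => A w * B (exp (α * I) * w) :=
    hA.mul (hB.comp (differentiable_id.const_mul _))
  rw [← norm_mul_exp_arg_mul_I z]
  refine norm_le_of_norm_le_on_sector_boundary (a := 0) (b := π / 2 - α)
    (differentiable_radialPrimitive hd) (hAg.mul (hBg.comp_const_mul _)).radialPrimitive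
    (by linarith) (fun r hr => ?_) (fun r hr => ?_) hz0 hzα (norm_pos_iff.2 hz)
  · refine norm_radialPrimitive_ray_le (by simp) hK (le_trans ?_ hAK) hr
    refine setLIntegral_mono_ae' measurableSet_Ioi (Eventually.of_forall fun t ht => ?_)
    rw [ofReal_zero, zero_mul, exp_zero, mul_one, enorm_mul, mul_comm (exp _)]
    gcongr
    exact (hBm _).trans_eq
      (by rw [norm_ofReal_mul_of_norm_eq_one (norm_exp_ofReal_mul_I α) (le_of_lt ht)])
  · refine norm_radialPrimitive_ray_le (norm_exp_ofReal_mul_I _) hK (le_trans ?_ hBK) hr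
    refine setLIntegral_mono_ae' measurableSet_Ioi (Eventually.of_forall fun t ht => ?_)
    rw [enorm_mul, mul_comm, mul_left_comm, hrot]
    gcongr
    exact (hAm _).trans_eq
      (by rw [norm_ofReal_mul_of_norm_eq_one (norm_exp_ofReal_mul_I _) (le_of_lt ht)])

/-- Rotating `B` by a small angle shrinks the quadrant to a sector in which Phragmén–Lindelöf
applies, with `A` controlling one boundary ray and `B` the other. -/
theorem norm_radialPrimitive_mul_le_of_mem_quadrant (hA : Differentiable ℂ A)
    (hB : Differentiable ℂ B) (hAg : HasGaussianGrowth A) (hBg : HasGaussianGrowth B)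
    (hAm : ∀ z, ‖A z‖ₑ ≤ m ‖z‖) (hBm : ∀ z, ‖B z‖ₑ ≤ m ‖z‖) (hK : K ≠ ⊤)
    (hAK : ∫⁻ r in Ioi (0 : ℝ), ‖A r‖ₑ * m r ≤ K)
    (hBK : ∫⁻ r in Ioi (0 : ℝ), ‖B (r * I)‖ₑ * m r ≤ K) {z : ℂ} (hre : 0 < z.re)
    (him : 0 ≤ z.im) : ‖radialPrimitive (fun w => A w * B w) z‖ ≤ K.toReal := by
  have hz : z ≠ 0 := fun h => by simp [h] at hre
  have harg : arg z < π / 2 := (abs_lt.1 (abs_arg_lt_pi_div_two_iff.2 (Or.inl hre))).2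
  have hcont : Continuous fun α : ℝ =>
      radialPrimitive (fun w => A w * B (exp (α * I) * w)) z := by
    have := hA.continuous
    have := hB.continuous
    exact continuous_radialPrimitive_param
      (H := fun (α : ℝ) w => A w * B (exp (α * I) * w)) (by fun_prop) z
  have hlim : Tendsto (fun α : ℝ => ‖radialPrimitive (fun w => A w * B (exp (α * I) * w)) z‖)
      (𝓝[>] 0) (𝓝 ‖radialPrimitive (fun w => A w * B w) z‖) := by
    simpa using (hcont.norm.tendsto 0).mono_left nhdsWithin_le_nhds
  refine le_of_tendsto hlim ?_
  filter_upwards [Ioo_mem_nhdsGT (sub_pos.2 harg)] with α hα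
  exact norm_radialPrimitive_mul_rotated_le hA hB hAg hBg hAm hBm hK hAK hBK hα.1 hz
    (arg_nonneg_iff.2 him) (by linarith [hα.2])

end Quadrant

theorem exists_rotation_mem_quadrant {z : ℂ} (hz : z ≠ 0) :
    ∃ c w : ℂ, (c = 1 ∨ c = I ∨ c = -1 ∨ c = -I) ∧ z = c * w ∧ 0 < w.re ∧ 0 ≤ w.im := by
  rcases lt_trichotomy z.re 0 with hre | hre | hre <;>
    rcases lt_trichotomy z.im 0 with him | him | him
  all_goals first
    | exact ⟨1, z, by simp, by simp, by linarith, by linarith⟩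
    | exact ⟨I, -I * z, by simp, by simp [← mul_assoc], by simpa, by simp [*, le_of_lt]⟩
    | exact ⟨-1, -z, by simp, by simp, by simpa, by simp [*, le_of_lt]⟩
    | exact ⟨-I, I * z, by simp, by simp [← mul_assoc], by simpa, by simp [*, le_of_lt]⟩
    | exact absurd (Complex.ext hre him) hz

section

variable {G : ℂ → ℂ} {m : ℝ → ℝ≥0∞}

theorem norm_radialPrimitive_mul_comp_I_mul_le (hG : Differentiable ℂ G)
    (hgrowth : HasGaussianGrowth G) (hm : ∀ z, ‖G z‖ₑ ≤ m ‖z‖)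
    (hK : ∫⁻ r in Ioi (0 : ℝ), (‖G r‖ₑ + ‖G (-r)‖ₑ) * m r ≠ ⊤) (z : ℂ) :
    ‖radialPrimitive (fun w => G w * G (I * w)) z‖ ≤
      (∫⁻ r in Ioi (0 : ℝ), (‖G r‖ₑ + ‖G (-r)‖ₑ) * m r).toReal := by
  set K := ∫⁻ r in Ioi (0 : ℝ), (‖G r‖ₑ + ‖G (-r)‖ₑ) * m r
  have hray {a : ℂ} (ha : a = 1 ∨ a = -1) :
      ∫⁻ r in Ioi (0 : ℝ), ‖G (a * r)‖ₑ * m r ≤ K := by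
    refine lintegral_mono fun r => ?_
    rcases ha with rfl | rfl
    · rw [one_mul]; gcongr; exact le_self_add
    · rw [neg_one_mul]; gcongr; exact le_add_self
  have hquadrant {a b : ℂ} (ha : a = 1 ∨ a = -1) (hb : b = I ∨ b = -I) {w : ℂ} (hre : 0 < w.re)
      (him : 0 ≤ w.im) : ‖radialPrimitive (fun w => G (a * w) * G (b * w)) w‖ ≤ K.toReal := by
    have hd (c : ℂ) : Differentiable ℂ fun w => G (c * w) :=
      hG.comp (differentiable_id.const_mul c)
    have hb' : b * I = 1 ∨ b * I = -1 := by rcases hb with rfl | rfl <;> simp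
    refine norm_radialPrimitive_mul_le_of_mem_quadrant (hd a) (hd b) (hgrowth.comp_const_mul a)
      (hgrowth.comp_const_mul b) (m := m) (fun v => (hm _).trans_eq ?_)
      (fun v => (hm _).trans_eq ?_) hK (hray ha) ?_ hre him
    · rcases ha with rfl | rfl <;> simp
    · rcases hb with rfl | rfl <;> simp
    · simpa only [mul_left_comm b, mul_comm _ (b * I)] using hray hb'
  rcases eq_or_ne z 0 with rfl | hz
  · simp [radialPrimitive]
  obtain ⟨c, w, hc, rfl, hre, him⟩ := exists_rotation_mem_quadrant hz
  have hc1 : ‖c‖ = 1 := by rcases hc with rfl | rfl | rfl | rfl <;> simp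
  rw [radialPrimitive_const_mul, norm_mul, hc1, one_mul]
  rcases hc with rfl | rfl | rfl | rfl
  · simpa using hquadrant (.inl rfl) (.inl rfl) hre him
  · simpa [← mul_assoc, mul_comm (G (I * _))] using hquadrant (.inr rfl) (.inl rfl) hre him
  · simpa using hquadrant (.inr rfl) (.inr rfl) hre him
  · simpa [← mul_assoc, mul_comm (G (-(I * _)))] using hquadrant (.inl rfl) (.inr rfl) hre him

theorem eq_zero_of_mul_comp_I_mul_eq_zero (hG : Differentiable ℂ G)
    (h : ∀ z, G z * G (I * z) = 0) (z : ℂ) : G z = 0 := by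
  by_contra hne
  have hev : ∀ᶠ w in 𝓝 z, G (I * w) = 0 := by
    filter_upwards [hG.continuous.continuousAt.eventually_ne hne] with w hw
    exact (mul_eq_zero.1 (h w)).resolve_left hw
  have han : AnalyticOnNhd ℂ (fun w => G (I * w)) univ :=
    (hG.comp (differentiable_id.const_mul I)).differentiableOn.analyticOnNhd isOpen_univ
  have hz := han.eqOn_zero_of_preconnected_of_eventuallyEq_zero isPreconnected_univ
    (mem_univ z) hev (mem_univ (-I * z))
  simp only [Pi.zero_apply, ← mul_assoc, mul_neg, I_mul_I, neg_neg, one_mul] at hz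
  exact hne hz

/-- Beurling's theorem in Hörmander's form: the primitive of `G z * G (i z)` is bounded, hence
constant. -/
theorem eq_zero_of_lintegral_mul_majorant_ne_top (hG : Differentiable ℂ G)
    (hgrowth : HasGaussianGrowth G) (hm : ∀ z, ‖G z‖ₑ ≤ m ‖z‖)
    (hK : ∫⁻ r in Ioi (0 : ℝ), (‖G r‖ₑ + ‖G (-r)‖ₑ) * m r ≠ ⊤) (z : ℂ) : G z = 0 := by
  refine eq_zero_of_mul_comp_I_mul_eq_zero hG (fun w => ?_) z
  have hprod : Differentiable ℂ fun w => G w * G (I * w) :=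
    hG.mul (hG.comp (differentiable_id.const_mul I))
  have hbdd : Bornology.IsBounded (range (radialPrimitive fun w => G w * G (I * w))) :=
    isBounded_iff_forall_norm_le.2 ⟨_, by
      rintro _ ⟨v, rfl⟩
      exact norm_radialPrimitive_mul_comp_I_mul_le hG hgrowth hm hK v⟩
  have hconst : (radialPrimitive fun w => G w * G (I * w)) = fun _ => radialPrimitive _ 0 :=
    funext fun v => (differentiable_radialPrimitive hprod).apply_eq_apply_of_bounded hbdd v 0
  have hderiv := hasDerivAt_radialPrimitive hprod w
  rw [hconst] at hderiv
  exact hderiv.unique (hasDerivAt_const w _)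

end

end Beurling

section Laguerre

open Filter Topology Set
open scoped Real ENNReal

/-- The values `L_k^a(-t) = ∑_{i ≤ k} C(k + a, k - i) t^i / i!` of the Laguerre polynomial on the
negative half-line, where all of its terms are nonnegative. -/
def laguerreNeg (a k : ℕ) (t : ℝ) : ℝ :=
  ∑ i ∈ Finset.range (k + 1), ((k + a).choose (k - i) : ℝ) * t ^ i / (i.factorial : ℝ)

theorem laguerreNeg_nonneg (a k : ℕ) {t : ℝ} (ht : 0 ≤ t) : 0 ≤ laguerreNeg a k t :=
  Finset.sum_nonneg fun _ _ => by positivity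

theorem laguerre_ofReal_neg (a k : ℕ) (t : ℝ) : laguerre a k (-t) = laguerreNeg a k t := by
  rw [laguerre, laguerreNeg]
  push_cast
  refine Finset.sum_congr rfl fun i _ => ?_
  rw [mul_right_comm, ← mul_pow, neg_one_mul, neg_neg, mul_comm]

theorem sum_sq_twoI {n : ℕ} (y : RSpace n) : ∑ j, twoI y j ^ 2 = (-(4 * ‖y‖ ^ 2) : ℝ) := by
  rw [EuclideanSpace.real_norm_sq_eq, Finset.mul_sum, ← Finset.sum_neg_distrib]
  push_cast
  refine Finset.sum_congr rfl fun j _ => ?_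
  simp only [twoI, mul_pow, Complex.I_sq]
  ring

theorem re_laguerreFun_twoI {n : ℕ} (a k : ℕ) (y : RSpace n) :
    (laguerreFun a k (twoI y)).re = laguerreNeg a k (2 * ‖y‖ ^ 2) * Real.exp (‖y‖ ^ 2) := by
  have hlag : (1 / 2 : ℂ) * (-(4 * ‖y‖ ^ 2) : ℝ) = -((2 * ‖y‖ ^ 2 : ℝ) : ℂ) := by
    push_cast; ring
  have hexp : -(1 / 4 : ℂ) * (-(4 * ‖y‖ ^ 2) : ℝ) = (‖y‖ ^ 2 : ℝ) := by push_cast; ring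
  rw [laguerreFun, sum_sq_twoI, hlag, hexp, laguerre_ofReal_neg, ← Complex.ofReal_exp,
    ← Complex.ofReal_mul, Complex.ofReal_re]

theorem hasSum_antidiagonal_of_nonneg {F : ℕ × ℕ → ℝ} (hF : ∀ p, 0 ≤ F p) {R : ℕ → ℝ} {T : ℝ}
    (hrow : ∀ i, HasSum (fun j => F (i, j)) (R i)) (hR : HasSum R T) :
    HasSum (fun k => ∑ p ∈ Finset.HasAntidiagonal.antidiagonal k, F p) T := by
  have hsummable : Summable F := (summable_prod_of_nonneg hF).2
    ⟨fun i => (hrow i).summable, by simpa only [(hrow _).tsum_eq] using hR.summable⟩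
  have htotal : HasSum F T := by
    rw [← (hsummable.hasSum.prod_fiberwise hrow).unique hR]
    exact hsummable.hasSum
  have hsigma : HasSum (fun x : Σ k : ℕ, Finset.HasAntidiagonal.antidiagonal k =>
      F (Finset.HasAntidiagonal.sigmaAntidiagonalEquivProd x)) T :=
    (Equiv.hasSum_iff Finset.HasAntidiagonal.sigmaAntidiagonalEquivProd).2 htotal
  exact hsigma.sigma (g := fun k => ∑ p ∈ Finset.HasAntidiagonal.antidiagonal k, F p) fun k =>
    (Finset.HasAntidiagonal.antidiagonal k).hasSum F

theorem hasSum_pow_div_factorial (x : ℝ) :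
    HasSum (fun k : ℕ => x ^ k / k.factorial) (Real.exp x) := by
  rw [Real.exp_eq_exp_ℝ]
  exact NormedSpace.expSeries_div_hasSum_exp x

theorem pow_mul_laguerreNeg_eq_sum_antidiagonal (a k : ℕ) (t r : ℝ) :
    r ^ k * laguerreNeg a k t = ∑ p ∈ Finset.HasAntidiagonal.antidiagonal k,
      (t * r) ^ p.1 / p.1.factorial * (((p.2 + (p.1 + a)).choose (p.1 + a) : ℝ) * r ^ p.2) := by
  rw [laguerreNeg, Finset.mul_sum, Finset.Nat.sum_antidiagonal_eq_sum_range_succ_mk]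
  refine Finset.sum_congr rfl fun i hi => ?_
  have hik : i ≤ k := Nat.lt_succ_iff.1 (Finset.mem_range.1 hi)
  have hadd : k - i + (i + a) = k + a := by omega
  have hchoose : (k + a).choose (i + a) = (k + a).choose (k - i) :=
    Nat.choose_symm_of_eq_add (by omega)
  have hpow : r ^ k = r ^ i * r ^ (k - i) := by rw [← pow_add, Nat.add_sub_cancel' hik]
  simp only [hadd, hchoose, hpow, mul_pow]
  ring

theorem hasSum_pow_mul_laguerreNeg (a : ℕ) {t r : ℝ} (ht : 0 ≤ t) (hr0 : 0 ≤ r) (hr1 : r < 1) :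
    HasSum (fun k => r ^ k * laguerreNeg a k t)
      (1 / (1 - r) ^ (a + 1) * Real.exp (t * r / (1 - r))) := by
  simp only [pow_mul_laguerreNeg_eq_sum_antidiagonal]
  refine hasSum_antidiagonal_of_nonneg
    (R := fun i => (t * r) ^ i / i.factorial * (1 / (1 - r) ^ (i + a + 1)))
    (fun p => by positivity) (fun i => HasSum.mul_left _ ?_) ?_
  · exact hasSum_choose_mul_geometric_of_norm_lt_one (i + a) (by rwa [Real.norm_of_nonneg hr0])
  · have hr : 0 < 1 - r := sub_pos.2 hr1
    refine ((hasSum_pow_div_factorial (t * r / (1 - r))).mul_left _).congr_fun fun i => ?_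
    rw [add_assoc, pow_add (1 - r) i, div_pow]
    field_simp

theorem eq_of_hasSum_pow_mul {a b : ℕ → ℝ} {S : ℝ → ℝ}
    (ha : ∀ r, 0 ≤ r → r < 1 → HasSum (fun k => r ^ k * a k) (S r))
    (hb : ∀ r, 0 ≤ r → r < 1 → HasSum (fun k => r ^ k * b k) (S r)) : a = b := by
  set c : ℕ → ℝ := fun k => a k - b k
  have hc (r : ℝ) (h0 : 0 ≤ r) (h1 : r < 1) : HasSum (fun k => r ^ k * c k) 0 := by
    simpa [c, mul_sub] using (ha r h0 h1).sub (hb r h0 h1)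
  set f : ℝ → ℝ := fun r => ∑' k, r ^ k * c k
  have hf : HasFPowerSeriesAt f (FormalMultilinearSeries.ofScalars ℝ c) 0 := by
    rw [hasFPowerSeriesAt_iff]
    filter_upwards [Metric.ball_mem_nhds (0 : ℝ) one_pos] with r hr
    have hr' : |r| < 1 := by simpa using hr
    have hs : Summable fun k => r ^ k * c k := by
      refine Summable.of_norm ?_
      simpa [abs_mul, abs_pow] using (hc |r| (abs_nonneg r) hr').summable.norm
    simpa [f] using hs.hasSum
  have hfreq : ∃ᶠ r in 𝓝[≠] (0 : ℝ), f r = 0 := by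
    have : ∀ᶠ r in 𝓝[>] (0 : ℝ), f r = 0 := by
      filter_upwards [Ioo_mem_nhdsGT (zero_lt_one' ℝ)] with r hr
      exact (hc r hr.1.le hr.2).tsum_eq
    exact this.frequently.filter_mono (nhdsWithin_mono _ fun r hr => ne_of_gt hr)
  have hev := hf.analyticAt.frequently_zero_iff_eventually_zero.1 hfreq
  funext k
  have hk : FormalMultilinearSeries.ofScalars ℝ c k = 0 := by rw [(hf.congr hev).eq_zero]; rfl
  rw [FormalMultilinearSeries.ofScalars_eq_zero] at hk
  exact sub_eq_zero.1 hk

end Laguerre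

section GaussianMoments

open scoped Real ENNReal

variable {V : Type*} [NormedAddCommGroup V] [InnerProductSpace ℝ V] [FiniteDimensional ℝ V]
  [MeasurableSpace V] [BorelSpace V]

theorem integrable_exp_neg_mul_sq_norm {b : ℝ} (hb : 0 < b) :
    Integrable fun w : V => Real.exp (-b * ‖w‖ ^ 2) := by
  refine Integrable.of_integral_ne_zero ?_
  rw [GaussianFourier.integral_rexp_neg_mul_sq_norm hb]
  positivity

theorem lintegral_exp_mul_sq_norm_sub_sq_norm_sub (y : V) {r : ℝ} (hr : r < 1) :
    ∫⁻ w : V, ENNReal.ofReal (Real.exp (r * ‖w‖ ^ 2 - ‖w - y‖ ^ 2)) =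
      ENNReal.ofReal ((π / (1 - r)) ^ (Module.finrank ℝ V / 2 : ℝ) *
        Real.exp (‖y‖ ^ 2 * r / (1 - r))) := by
  have hr' : 0 < 1 - r := sub_pos.2 hr
  have hsq (w : V) : Real.exp (r * ‖w‖ ^ 2 - ‖w - y‖ ^ 2) =
      Real.exp (-(1 - r) * ‖w - (1 - r)⁻¹ • y‖ ^ 2) * Real.exp (‖y‖ ^ 2 * r / (1 - r)) := by
    rw [← Real.exp_add, norm_sub_sq_real, norm_sub_sq_real, norm_smul, inner_smul_right,
      Real.norm_of_nonneg (by positivity)]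
    congr 1
    field_simp
    ring
  simp_rw [hsq, ENNReal.ofReal_mul (Real.exp_nonneg _)]
  rw [lintegral_mul_const' _ _ ENNReal.ofReal_ne_top,
    lintegral_sub_right_eq_self fun w : V => ENNReal.ofReal (Real.exp (-(1 - r) * ‖w‖ ^ 2)),
    ← ofReal_integral_eq_lintegral_ofReal (integrable_exp_neg_mul_sq_norm hr')
      (ae_of_all _ fun _ => Real.exp_nonneg _),
    GaussianFourier.integral_rexp_neg_mul_sq_norm hr', ← ENNReal.ofReal_mul (by positivity)]

/-- The moment of order `2 * k` of the unnormalised Gaussian `exp (-‖w - y‖ ^ 2)`. -/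
def evenGaussianMoment (k : ℕ) (y : V) : ℝ≥0∞ :=
  ∫⁻ w : V, ENNReal.ofReal ((‖w‖ ^ 2) ^ k * Real.exp (-‖w - y‖ ^ 2))

theorem tsum_evenGaussianMoment (y : V) {r : ℝ} (hr0 : 0 ≤ r) (hr1 : r < 1) :
    ∑' k : ℕ, ENNReal.ofReal (r ^ k / k.factorial) * evenGaussianMoment k y =
      ENNReal.ofReal ((π / (1 - r)) ^ (Module.finrank ℝ V / 2 : ℝ) *
        Real.exp (‖y‖ ^ 2 * r / (1 - r))) := by
  have hseries (w : V) : ∑' k : ℕ, ENNReal.ofReal (r ^ k / k.factorial) *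
      ENNReal.ofReal ((‖w‖ ^ 2) ^ k * Real.exp (-‖w - y‖ ^ 2)) =
        ENNReal.ofReal (Real.exp (r * ‖w‖ ^ 2 - ‖w - y‖ ^ 2)) := by
    have h := (hasSum_pow_div_factorial (r * ‖w‖ ^ 2)).mul_right (Real.exp (-‖w - y‖ ^ 2))
    rw [sub_eq_add_neg (r * _), Real.exp_add, ← h.tsum_eq,
      ENNReal.ofReal_tsum_of_nonneg (fun k => by positivity) h.summable]
    refine tsum_congr fun k => ?_
    rw [← ENNReal.ofReal_mul (by positivity), mul_pow]
    congr 1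
    ring
  have hmeas (k : ℕ) :
      Measurable fun w : V => ENNReal.ofReal ((‖w‖ ^ 2) ^ k * Real.exp (-‖w - y‖ ^ 2)) := by
    fun_prop
  simp_rw [evenGaussianMoment, ← lintegral_const_mul' _ _ ENNReal.ofReal_ne_top]
  rw [← lintegral_tsum fun k => ((hmeas k).const_mul _).aemeasurable]
  simp_rw [hseries]
  exact lintegral_exp_mul_sq_norm_sub_sq_norm_sub y hr1

theorem evenGaussianMoment_ne_top (k : ℕ) (y : V) : evenGaussianMoment k y ≠ ⊤ := fun hk => by
  have h := ENNReal.le_tsum (f := fun k : ℕ =>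
    ENNReal.ofReal ((1 / 2 : ℝ) ^ k / k.factorial) * evenGaussianMoment k y) k
  rw [tsum_evenGaussianMoment y (by norm_num) (by norm_num), hk, ENNReal.mul_top
    (by rw [Ne, ENNReal.ofReal_eq_zero, not_le]; positivity), top_le_iff] at h
  exact ENNReal.ofReal_ne_top h

theorem evenGaussianMoment_eq {a : ℕ} (ha : Module.finrank ℝ V = 2 * (a + 1)) (k : ℕ) (y : V) :
    evenGaussianMoment k y =
      ENNReal.ofReal (π ^ (a + 1) * k.factorial * laguerreNeg a k (‖y‖ ^ 2)) := by
  have hfin (k : ℕ) := evenGaussianMoment_ne_top k y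
  have hcoeff : (fun k : ℕ => (evenGaussianMoment k y).toReal / k.factorial) =
      fun k => π ^ (a + 1) * laguerreNeg a k (‖y‖ ^ 2) := by
    refine eq_of_hasSum_pow_mul (S := fun r => (π / (1 - r)) ^ (a + 1) *
      Real.exp (‖y‖ ^ 2 * r / (1 - r))) (fun r h0 h1 => ?_) fun r h0 h1 => ?_
    · have h := tsum_evenGaussianMoment y h0 h1
      have : 0 < 1 - r := sub_pos.2 h1
      have hdim : (Module.finrank ℝ V / 2 : ℝ) = (a + 1 : ℕ) := by rw [ha]; push_cast; ring
      have hs := ENNReal.hasSum_toReal (h ▸ ENNReal.ofReal_ne_top)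
      rw [← ENNReal.tsum_toReal_eq fun k => ENNReal.mul_ne_top ENNReal.ofReal_ne_top (hfin k), h,
        ENNReal.toReal_ofReal (by positivity), hdim, Real.rpow_natCast] at hs
      refine hs.congr_fun fun k => ?_
      rw [ENNReal.toReal_mul, ENNReal.toReal_ofReal (by positivity)]
      ring
    · have h := (hasSum_pow_mul_laguerreNeg a (sq_nonneg ‖y‖) h0 h1).mul_left (π ^ (a + 1))
      rw [div_pow, div_eq_mul_one_div, mul_assoc]
      simpa only [mul_left_comm] using h
  have hk := congrFun hcoeff k
  rw [div_eq_iff (by positivity)] at hk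
  rw [← ENNReal.ofReal_toReal (hfin k), hk, mul_right_comm]

/-- On `V × V` the product `2 ‖u‖ ‖v‖` is at most `‖(u, v)‖ ^ 2`, so the square of a moment on `V`
is at most an even moment on `V × V`, whose dimension is even. -/
theorem sq_lintegral_pow_norm_mul_gaussian_le {a : ℕ} (ha : Module.finrank ℝ V = a + 1) (k : ℕ)
    (x : V) :
    (∫⁻ u : V, ENNReal.ofReal ((√2 * ‖u‖) ^ k * Real.exp (-‖u - x‖ ^ 2))) ^ 2 ≤
      ENNReal.ofReal (π ^ (a + 1) * k.factorial * laguerreNeg a k (2 * ‖x‖ ^ 2)) := by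
  have hnorm : ‖WithLp.toLp 2 (x, x)‖ ^ 2 = 2 * ‖x‖ ^ 2 :=
    (WithLp.prod_norm_sq_eq_of_L2 _).trans (two_mul _).symm
  have hdim : Module.finrank ℝ (WithLp 2 (V × V)) = 2 * (a + 1) := by
    rw [(WithLp.linearEquiv 2 ℝ (V × V)).finrank_eq, Module.finrank_prod, ha, two_mul]
  have hmeas : Measurable fun u : V =>
      ENNReal.ofReal ((√2 * ‖u‖) ^ k * Real.exp (-‖u - x‖ ^ 2)) := by
    fun_prop
  rw [← hnorm, ← evenGaussianMoment_eq hdim, evenGaussianMoment,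
    ← (WithLp.volume_preserving_toLp V V).lintegral_comp (by fun_prop), sq,
    ← lintegral_prod_mul hmeas.aemeasurable hmeas.aemeasurable]
  refine lintegral_mono fun p => ?_
  rw [← ENNReal.ofReal_mul (by positivity), WithLp.prod_norm_sq_eq_of_L2,
    WithLp.prod_norm_sq_eq_of_L2]
  refine ENNReal.ofReal_le_ofReal ?_
  have hsqrt : 2 * ‖p.1‖ * ‖p.2‖ = √2 * ‖p.1‖ * (√2 * ‖p.2‖) := by
    rw [mul_mul_mul_comm, Real.mul_self_sqrt zero_le_two, mul_assoc]
  calc (√2 * ‖p.1‖) ^ k * Real.exp (-‖p.1 - x‖ ^ 2) *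
        ((√2 * ‖p.2‖) ^ k * Real.exp (-‖p.2 - x‖ ^ 2))
      = (2 * ‖p.1‖ * ‖p.2‖) ^ k * Real.exp (-(‖p.1 - x‖ ^ 2 + ‖p.2 - x‖ ^ 2)) := by
        rw [neg_add, Real.exp_add, hsqrt, mul_pow]
        ring
    _ ≤ (‖p.1‖ ^ 2 + ‖p.2‖ ^ 2) ^ k * Real.exp (-(‖p.1 - x‖ ^ 2 + ‖p.2 - x‖ ^ 2)) := by
        gcongr
        exact two_mul_le_add_sq _ _

end GaussianMoments

section PolynomialGaussian

open scoped Real LineDeriv Laplacian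

variable {E : Type*} [NormedAddCommGroup E] [InnerProductSpace ℝ E]

theorem one_add_pow_mul_exp_neg_sq_le (M : ℕ) {t : ℝ} (ht : 0 ≤ t) :
    (1 + t) ^ M * Real.exp (-t ^ 2 / 2) ≤ M.factorial * Real.exp (3 / 2) := by
  have hpow : (1 + t) ^ M ≤ M.factorial * Real.exp (1 + t) := by
    have := Real.pow_div_factorial_le_exp (1 + t) (by linarith) M
    rwa [div_le_iff₀' (by positivity)] at this
  calc (1 + t) ^ M * Real.exp (-t ^ 2 / 2)
      ≤ M.factorial * Real.exp (1 + t) * Real.exp (-t ^ 2 / 2) := by gcongr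
    _ = M.factorial * Real.exp (1 + t + -t ^ 2 / 2) := by rw [mul_assoc, ← Real.exp_add]
    _ ≤ M.factorial * Real.exp (3 / 2) := by
      gcongr
      nlinarith [sq_nonneg (t - 1)]

theorem exists_norm_iteratedFDeriv_exp_neg_sq_norm_le (n : ℕ) :
    ∃ (C : ℝ) (l : ℕ), 0 ≤ C ∧ ∀ x : E,
      ‖iteratedFDeriv ℝ n (fun y : E => ((Real.exp (-‖y‖ ^ 2 / 2) : ℝ) : ℂ)) x‖ ≤
        C * (1 + ‖x‖) ^ l * Real.exp (-‖x‖ ^ 2 / 2) := by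
  have hcd : ContDiff ℝ n fun x : E => -‖x‖ ^ 2 / 2 := (contDiff_norm_sq ℝ).neg.div_const 2
  have hgrowth : (fun x : E => -‖x‖ ^ 2 / 2).HasTemperateGrowth := by
    simp only [div_eq_mul_inv]
    fun_prop
  obtain ⟨l, C, hC, hbound⟩ := hgrowth.norm_iteratedFDeriv_le_uniform n
  refine ⟨n.factorial * (1 + C) ^ n, l * n, by positivity, fun x => ?_⟩
  have hx : 0 ≤ ‖x‖ := norm_nonneg x
  have hbase : 1 ≤ (1 + C) * (1 + ‖x‖) ^ l :=
    one_le_mul_of_one_le_of_one_le (by linarith) (one_le_pow₀ (by linarith))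
  have hinner (i : ℕ) (hi : 1 ≤ i) (hin : i ≤ n) :
      ‖iteratedFDeriv ℝ i (fun x : E => -‖x‖ ^ 2 / 2) x‖ ≤ ((1 + C) * (1 + ‖x‖) ^ l) ^ i := by
    refine (hbound i hin x).trans (le_trans ?_ (le_self_pow₀ hbase (by omega)))
    gcongr
    linarith
  have houter (i : ℕ) : ‖iteratedFDeriv ℝ i Real.exp (-‖x‖ ^ 2 / 2)‖ ≤
      Real.exp (-‖x‖ ^ 2 / 2) := by
    rw [norm_iteratedFDeriv_eq_norm_iteratedDeriv, iteratedDeriv_eq_iterate, Real.iter_deriv_exp,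
      Real.norm_of_nonneg (Real.exp_nonneg _)]
  change ‖iteratedFDeriv ℝ n (Complex.ofRealLI ∘ (Real.exp ∘ fun y : E => -‖y‖ ^ 2 / 2)) x‖ ≤ _
  rw [LinearIsometry.norm_iteratedFDeriv_comp_left _
    (Real.contDiff_exp.comp hcd).contDiffAt le_rfl]
  refine (norm_iteratedFDeriv_comp_le Real.contDiff_exp hcd le_rfl x (fun i _ => houter i)
    hinner).trans (le_of_eq ?_)
  rw [mul_pow, pow_mul]
  ring

variable (E) in
/-- The Gaussian `exp (-‖x‖ ^ 2 / 2)` as a Schwartz function. -/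
def gaussianSchwartz : 𝓢(E, ℂ) where
  toFun x := ((Real.exp (-‖x‖ ^ 2 / 2) : ℝ) : ℂ)
  smooth' := Complex.ofRealCLM.contDiff.comp
    (Real.contDiff_exp.comp ((contDiff_norm_sq ℝ).neg.div_const 2))
  decay' k n := by
    obtain ⟨C, l, hC, hbound⟩ := exists_norm_iteratedFDeriv_exp_neg_sq_norm_le (E := E) n
    refine ⟨C * ((k + l).factorial * Real.exp (3 / 2)), fun x => ?_⟩
    calc ‖x‖ ^ k * _
        ≤ (1 + ‖x‖) ^ k * (C * (1 + ‖x‖) ^ l * Real.exp (-‖x‖ ^ 2 / 2)) := by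
          gcongr
          · linarith
          · exact hbound x
      _ = C * ((1 + ‖x‖) ^ (k + l) * Real.exp (-‖x‖ ^ 2 / 2)) := by rw [pow_add]; ring
      _ ≤ C * ((k + l).factorial * Real.exp (3 / 2)) := by
          exact mul_le_mul_of_nonneg_left (one_add_pow_mul_exp_neg_sq_le _ (norm_nonneg x)) hC

theorem gaussianSchwartz_apply (x : E) :
    gaussianSchwartz E x = ((Real.exp (-‖x‖ ^ 2 / 2) : ℝ) : ℂ) := rfl

theorem hasTemperateGrowth_eval_inner (P : Polynomial ℝ) (η : E) :
    (fun x : E => ((P.eval (inner ℝ η x) : ℝ) : ℂ)).HasTemperateGrowth := by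
  have hreal : (fun x : E => P.eval (inner ℝ η x)).HasTemperateGrowth := by
    simp_rw [Polynomial.eval_eq_sum_range]
    refine Function.HasTemperateGrowth.sum fun i _ => ?_
    exact (Function.HasTemperateGrowth.const _).mul
      ((Function.hasTemperateGrowth_inner_right η).pow i)
  fun_prop

/-- The Schwartz function `P(⟪η, x⟫) exp (-‖x‖ ^ 2 / 2)`. -/
def polyGaussian (η : E) (P : Polynomial ℝ) : 𝓢(E, ℂ) :=
  SchwartzMap.smulLeftCLM ℂ (fun x : E => ((P.eval (inner ℝ η x) : ℝ) : ℂ)) (gaussianSchwartz E)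

theorem polyGaussian_apply (η : E) (P : Polynomial ℝ) (x : E) :
    polyGaussian η P x = ((P.eval (inner ℝ η x) * Real.exp (-‖x‖ ^ 2 / 2) : ℝ) : ℂ) := by
  rw [polyGaussian, SchwartzMap.smulLeftCLM_apply_apply (hasTemperateGrowth_eval_inner P η),
    gaussianSchwartz_apply, smul_eq_mul, Complex.ofReal_mul]

theorem hasDerivAt_exp_neg_sq_norm_line (x v : E) :
    HasDerivAt (fun t : ℝ => Real.exp (-‖x + t • v‖ ^ 2 / 2))
      (-inner ℝ v x * Real.exp (-‖x‖ ^ 2 / 2)) 0 := by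
  have hline : HasDerivAt (fun t : ℝ => x + t • v) v 0 := by
    simpa using ((hasDerivAt_id (0 : ℝ)).smul_const v).const_add x
  have h := (hline.norm_sq.neg.div_const 2).exp
  simp only [Pi.neg_apply, zero_smul, add_zero] at h
  refine h.congr_deriv ?_
  rw [real_inner_comm]
  ring

theorem hasDerivAt_inner_line (w x v : E) :
    HasDerivAt (fun t : ℝ => inner ℝ w (x + t • v)) (inner ℝ w v) 0 := by
  simp only [inner_add_right, inner_smul_right]
  simpa using ((hasDerivAt_id (0 : ℝ)).mul_const (inner ℝ w v)).const_add (inner ℝ w x)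

theorem hasDerivAt_eval_inner_line (P : Polynomial ℝ) (η x v : E) :
    HasDerivAt (fun t : ℝ => P.eval (inner ℝ η (x + t • v)))
      (inner ℝ η v * P.derivative.eval (inner ℝ η x)) 0 := by
  have h := (P.hasDerivAt (inner ℝ η (x + (0 : ℝ) • v))).comp (0 : ℝ) (hasDerivAt_inner_line η x v)
  simp only [zero_smul, add_zero] at h
  exact h.congr_deriv (mul_comm _ _)

theorem lineDeriv_polyGaussian (η : E) (P : Polynomial ℝ) (v x : E) :
    (∂_{v} (polyGaussian η P)) x =
      (((inner ℝ η v * P.derivative.eval (inner ℝ η x) - inner ℝ v x * P.eval (inner ℝ η x)) *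
        Real.exp (-‖x‖ ^ 2 / 2) : ℝ) : ℂ) := by
  rw [SchwartzMap.lineDerivOp_apply]
  refine HasLineDerivAt.lineDeriv ?_
  have h := ((hasDerivAt_eval_inner_line P η x v).mul
    (hasDerivAt_exp_neg_sq_norm_line x v)).ofReal_comp
  simp only [zero_smul, add_zero] at h
  simp only [HasLineDerivAt, polyGaussian_apply]
  refine h.congr_deriv ?_
  congr 1
  ring

theorem lineDeriv_lineDeriv_polyGaussian (η : E) (P : Polynomial ℝ) (v x : E) :
    (∂_{v} (∂_{v} (polyGaussian η P))) x =
      (((inner ℝ η v ^ 2 * P.derivative.derivative.eval (inner ℝ η x) -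
        ‖v‖ ^ 2 * P.eval (inner ℝ η x) -
        2 * (inner ℝ η v * inner ℝ v x) * P.derivative.eval (inner ℝ η x) +
        inner ℝ v x ^ 2 * P.eval (inner ℝ η x)) * Real.exp (-‖x‖ ^ 2 / 2) : ℝ) : ℂ) := by
  rw [SchwartzMap.lineDerivOp_apply]
  refine HasLineDerivAt.lineDeriv ?_
  have h := ((((hasDerivAt_eval_inner_line P.derivative η x v).const_mul (inner ℝ η v)).sub
    ((hasDerivAt_inner_line v x v).mul (hasDerivAt_eval_inner_line P η x v))).mul
      (hasDerivAt_exp_neg_sq_norm_line x v)).ofReal_comp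
  simp only [zero_smul, add_zero, Pi.mul_apply, Pi.sub_apply] at h
  simp only [HasLineDerivAt, lineDeriv_polyGaussian]
  refine h.congr_deriv ?_
  congr 1
  rw [real_inner_self_eq_norm_sq]
  ring

theorem laplacian_polyGaussian [FiniteDimensional ℝ E] (η : E) (P : Polynomial ℝ) (x : E) :
    (Δ (polyGaussian η P)) x =
      (((‖η‖ ^ 2 * P.derivative.derivative.eval (inner ℝ η x) -
        2 * inner ℝ η x * P.derivative.eval (inner ℝ η x) +
        (‖x‖ ^ 2 - Module.finrank ℝ E) * P.eval (inner ℝ η x)) *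
          Real.exp (-‖x‖ ^ 2 / 2) : ℝ) : ℂ) := by
  let b := stdOrthonormalBasis ℝ E
  rw [SchwartzMap.laplacian_eq_sum b, sum_apply]
  simp only [lineDeriv_lineDeriv_polyGaussian]
  rw [← Complex.ofReal_sum, ← Finset.sum_mul]
  congr 2
  have hdim : ∑ i, ‖b i‖ ^ 2 = (Module.finrank ℝ E : ℝ) := by simp
  rw [Finset.sum_add_distrib, Finset.sum_sub_distrib, Finset.sum_sub_distrib, ← Finset.sum_mul,
    ← Finset.sum_mul, ← Finset.sum_mul, ← Finset.sum_mul, ← Finset.mul_sum, hdim,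
    b.sum_sq_inner_left, b.sum_sq_inner_right, b.sum_inner_mul_inner]
  ring

end PolynomialGaussian

section HermiteFunctions

open scoped Real LineDeriv Laplacian

theorem derivative_hermite_succ (k : ℕ) :
    (Polynomial.hermite (k + 1)).derivative = ((k : Polynomial ℤ) + 1) * Polynomial.hermite k := by
  induction k with
  | zero => simp
  | succ k ih =>
    rw [Polynomial.hermite_succ (k + 1), Polynomial.derivative_sub, Polynomial.derivative_mul, ih]
    simp only [Polynomial.derivative_X, Polynomial.derivative_mul, Polynomial.derivative_add,
      Polynomial.derivative_natCast, Polynomial.derivative_one, Polynomial.hermite_succ k]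
    push_cast
    ring

theorem derivative_derivative_hermite (k : ℕ) :
    (Polynomial.hermite k).derivative.derivative =
      Polynomial.X * (Polynomial.hermite k).derivative -
        (k : Polynomial ℤ) * Polynomial.hermite k := by
  have h := derivative_hermite_succ k
  rw [Polynomial.hermite_succ, Polynomial.derivative_sub, Polynomial.derivative_mul,
    Polynomial.derivative_X] at h
  linear_combination -h

theorem iteratedDeriv_hermite_generating_function (s : ℂ) (k : ℕ) :
    iteratedDeriv k (fun τ : ℂ => Complex.exp (s * τ - τ ^ 2 / 2)) = fun τ =>
      Polynomial.aeval (s - τ) (Polynomial.hermite k) * Complex.exp (s * τ - τ ^ 2 / 2) := by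
  induction k with
  | zero => simp
  | succ k ih =>
    rw [iteratedDeriv_succ, ih]
    funext τ
    have hsub : HasDerivAt (fun τ : ℂ => s - τ) (-1) τ := by
      simpa using (hasDerivAt_id τ).const_sub s
    have hexp : HasDerivAt (fun τ : ℂ => Complex.exp (s * τ - τ ^ 2 / 2))
        (Complex.exp (s * τ - τ ^ 2 / 2) * (s - τ)) τ := by
      simpa using (((hasDerivAt_id τ).const_mul s).sub
        (((hasDerivAt_id τ).pow 2).div_const 2)).cexp
    have hprod := (((Polynomial.hermite k).hasDerivAt_aeval (s - τ)).comp τ hsub).mul hexp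
    refine hprod.deriv.trans ?_
    simp only [Polynomial.hermite_succ, map_sub, map_mul, Polynomial.aeval_X, Function.comp_apply]
    ring

theorem hasSum_hermite_generating_function (s τ : ℂ) :
    HasSum (fun k : ℕ => τ ^ k / k.factorial * Polynomial.aeval s (Polynomial.hermite k))
      (Complex.exp (s * τ - τ ^ 2 / 2)) := by
  have hd : Differentiable ℂ fun τ : ℂ => Complex.exp (s * τ - τ ^ 2 / 2) := by fun_prop
  refine (Complex.hasSum_taylorSeries_of_entire hd 0 τ).congr_fun fun k => ?_
  simp only [iteratedDeriv_hermite_generating_function, sub_zero, mul_zero, smul_eq_mul, ne_eq,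
    OfNat.ofNat_ne_zero, not_false_eq_true, zero_pow, zero_div, Complex.exp_zero, mul_one]
  ring

section

variable {E : Type*} [NormedAddCommGroup E] [InnerProductSpace ℝ E]

/-- The function `He_k(⟪η, x⟫) exp (-‖x‖ ^ 2 / 2)`, where `He_k` is the probabilists' Hermite
polynomial. It is a Hermite function in the direction of `η` exactly when `‖η‖ ^ 2 = 2`. -/
def directionalHermite (η : E) (k : ℕ) : 𝓢(E, ℂ) :=
  polyGaussian η ((Polynomial.hermite k).map (algebraMap ℤ ℝ))

theorem directionalHermite_apply (η : E) (k : ℕ) (x : E) :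
    directionalHermite η k x =
      ((Polynomial.aeval (inner ℝ η x) (Polynomial.hermite k) * Real.exp (-‖x‖ ^ 2 / 2) : ℝ) :
        ℂ) := by
  rw [directionalHermite, polyGaussian_apply, Polynomial.eval_map_algebraMap]

theorem lineDeriv_directionalHermite (η : E) (k : ℕ) (v x : E) :
    (∂_{v} (directionalHermite η k)) x =
      (((inner ℝ η v * Polynomial.aeval (inner ℝ η x) (Polynomial.hermite k).derivative -
        inner ℝ v x * Polynomial.aeval (inner ℝ η x) (Polynomial.hermite k)) *
          Real.exp (-‖x‖ ^ 2 / 2) : ℝ) : ℂ) := by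
  rw [directionalHermite, lineDeriv_polyGaussian, Polynomial.derivative_map,
    Polynomial.eval_map_algebraMap, Polynomial.eval_map_algebraMap]

variable {η : E} (hη : ‖η‖ ^ 2 = 2)

include hη

theorem inner_mul_directionalHermite_sub_lineDeriv (k : ℕ) (x : E) :
    inner ℝ η x * directionalHermite η k x - (∂_{η} (directionalHermite η k)) x =
      2 * directionalHermite η (k + 1) x := by
  rw [lineDeriv_directionalHermite, directionalHermite_apply, directionalHermite_apply,
    real_inner_self_eq_norm_sq, hη, Polynomial.hermite_succ, map_sub, map_mul, Polynomial.aeval_X]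
  push_cast
  ring

theorem inner_mul_directionalHermite_add_lineDeriv (k : ℕ) (x : E) :
    inner ℝ η x * directionalHermite η (k + 1) x + (∂_{η} (directionalHermite η (k + 1))) x =
      2 * (k + 1) * directionalHermite η k x := by
  rw [lineDeriv_directionalHermite, directionalHermite_apply, directionalHermite_apply,
    real_inner_self_eq_norm_sq, hη, derivative_hermite_succ, map_mul, map_add, map_natCast, map_one]
  push_cast
  ring

theorem laplacian_directionalHermite [FiniteDimensional ℝ E] (k : ℕ) (x : E) :
    (Δ (directionalHermite η k)) x =
      ((‖x‖ ^ 2 : ℝ) - (2 * k + Module.finrank ℝ E : ℂ)) * directionalHermite η k x := by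
  rw [directionalHermite_apply, directionalHermite, laplacian_polyGaussian, hη,
    Polynomial.derivative_map, Polynomial.derivative_map, Polynomial.eval_map_algebraMap,
    Polynomial.eval_map_algebraMap, Polynomial.eval_map_algebraMap, derivative_derivative_hermite,
    map_sub, map_mul, map_mul, Polynomial.aeval_X, map_natCast]
  push_cast
  ring

end

section

variable {E : Type*} [NormedAddCommGroup E] [InnerProductSpace ℝ E] [FiniteDimensional ℝ E]
  [MeasurableSpace E] [BorelSpace E]

theorem integrable_schwartz_mul_schwartz (f g : 𝓢(E, ℂ)) : Integrable fun x => f x * g x :=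
  (SchwartzMap.pairing (ContinuousLinearMap.mul ℝ ℂ) f g).integrable

/-- The raising operator `⟪η, ·⟫ - ∂_η` is the transpose of the lowering operator
`⟪η, ·⟫ + ∂_η`, by integration by parts. -/
theorem integral_directionalHermite_succ_sq {η : E} (hη : ‖η‖ ^ 2 = 2) (k : ℕ) :
    ∫ x : E, directionalHermite η (k + 1) x ^ 2 =
      (k + 1) * ∫ x : E, directionalHermite η k x ^ 2 := by
  set h := directionalHermite η k
  set h' := directionalHermite η (k + 1)
  let mulInner : 𝓢(E, ℂ) := SchwartzMap.smulLeftCLM ℂ (fun x : E => ((inner ℝ η x : ℝ) : ℂ)) h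
  have mulInner_apply (x : E) : mulInner x = inner ℝ η x * h x :=
    SchwartzMap.smulLeftCLM_apply_apply (by fun_prop) h x
  calc ∫ x, h' x ^ 2
      = ∫ x, 1 / 2 * (mulInner x * h' x - (∂_{η} h) x * h' x) := by
        refine integral_congr_ae (ae_of_all _ fun x => ?_)
        have hraise := inner_mul_directionalHermite_sub_lineDeriv hη k x
        simp only [mulInner_apply]
        linear_combination -(1 / 2) * h' x * hraise
    _ = ∫ x, 1 / 2 * (mulInner x * h' x + h x * (∂_{η} h') x) := by
        simp_rw [integral_const_mul]
        rw [integral_sub (integrable_schwartz_mul_schwartz _ _)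
            (integrable_schwartz_mul_schwartz _ _),
          integral_add (integrable_schwartz_mul_schwartz _ _)
            (integrable_schwartz_mul_schwartz _ _),
          SchwartzMap.integral_mul_lineDerivOp_right_eq_neg_left, sub_eq_add_neg]
    _ = ∫ x, (k + 1) * h x ^ 2 := by
        refine integral_congr_ae (ae_of_all _ fun x => ?_)
        have hlower := inner_mul_directionalHermite_add_lineDeriv hη k x
        simp only [mulInner_apply]
        linear_combination 1 / 2 * h x * hlower
    _ = (k + 1) * ∫ x, h x ^ 2 := integral_const_mul _ _

theorem integral_directionalHermite_sq {η : E} (hη : ‖η‖ ^ 2 = 2) (k : ℕ) :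
    ∫ x : E, directionalHermite η k x ^ 2 =
      ((π ^ (Module.finrank ℝ E / 2 : ℝ) * k.factorial : ℝ) : ℂ) := by
  induction k with
  | zero =>
    have hsq (x : E) : directionalHermite η 0 x ^ 2 = ((Real.exp (-1 * ‖x‖ ^ 2) : ℝ) : ℂ) := by
      rw [directionalHermite_apply, ← Complex.ofReal_pow, Polynomial.hermite_zero, map_one,
        map_one, one_mul, ← Real.exp_nat_mul]
      congr 2
      push_cast
      ring
    simp_rw [hsq]
    rw [integral_complex_ofReal, GaussianFourier.integral_rexp_neg_mul_sq_norm one_pos]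
    simp
  | succ k ih =>
    rw [integral_directionalHermite_succ_sq hη, ih, Nat.factorial_succ]
    push_cast
    ring

theorem norm_toLp_directionalHermite {η : E} (hη : ‖η‖ ^ 2 = 2) (k : ℕ) :
    ‖(directionalHermite η k).toLp 2 (volume : Measure E)‖ =
      √(π ^ (Module.finrank ℝ E / 2 : ℝ) * k.factorial) := by
  have hnorm := inner_self_eq_norm_sq_to_K (𝕜 := ℂ)
    ((directionalHermite η k).toLp 2 (volume : Measure E))
  rw [SchwartzMap.inner_toL2_toL2_eq _ _ volume] at hnorm
  have hreal : ∫ x : E, inner ℂ (directionalHermite η k x) (directionalHermite η k x) =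
      ∫ x : E, directionalHermite η k x ^ 2 := by
    refine integral_congr_ae (ae_of_all _ fun x => ?_)
    simp only [directionalHermite_apply, RCLike.inner_apply, Complex.conj_ofReal, sq]
  rw [hreal, integral_directionalHermite_sq hη] at hnorm
  refine (Real.sqrt_eq_iff_eq_sq (by positivity) (norm_nonneg _)).2 ?_ |>.symm
  exact Complex.ofReal_injective (hnorm.trans (Complex.ofReal_pow _ 2).symm)

end

section

variable {n : ℕ}

theorem toLp_mem_hermiteEigenspace {k : ℕ} {g : 𝓢(RSpace n, ℂ)}
    (hg : ∀ x, -(Δ g) x + ((‖x‖ ^ 2 : ℝ) : ℂ) * g x = (2 * k + n : ℂ) * g x) :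
    g.toLp 2 (volume : Measure (RSpace n)) ∈ hermiteEigenspace n k := by
  rw [mem_hermiteEigenspace_iff]
  ext ψ
  let mulSq : 𝓢(RSpace n, ℂ) :=
    SchwartzMap.smulLeftCLM ℂ (fun x : RSpace n => ((‖x‖ ^ 2 : ℝ) : ℂ)) ψ
  have mulSq_apply (x) : mulSq x = ((‖x‖ ^ 2 : ℝ) : ℂ) * ψ x :=
    SchwartzMap.smulLeftCLM_apply_apply (by fun_prop) ψ x
  rw [hermiteOperator_apply n _ ψ (-Δ ψ + mulSq) fun x => by
      rw [add_apply, neg_apply, mulSq_apply],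
    Lp.toTemperedDistribution_toLp_eq, smul_apply,
    SchwartzMap.toTemperedDistributionCLM_apply_apply volume,
    SchwartzMap.toTemperedDistributionCLM_apply_apply volume, smul_eq_mul, ← integral_const_mul]
  calc ∫ x, (-Δ ψ + mulSq) x • g x = ∫ x, (g x * mulSq x - g x * (Δ ψ) x) := by
        refine integral_congr_ae (ae_of_all _ fun x => ?_)
        simp only [add_apply, neg_apply, smul_eq_mul]
        ring
    _ = ∫ x, (g x * mulSq x - (Δ g) x * ψ x) := by
        rw [integral_sub (integrable_schwartz_mul_schwartz _ _)
            (integrable_schwartz_mul_schwartz _ _),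
          integral_sub (integrable_schwartz_mul_schwartz _ _)
            (integrable_schwartz_mul_schwartz _ _),
          SchwartzMap.integral_mul_laplacian_right_eq_left]
    _ = ∫ x, (2 * k + n : ℂ) * ψ x • g x := by
        refine integral_congr_ae (ae_of_all _ fun x => ?_)
        simp only [mulSq_apply, smul_eq_mul]
        linear_combination ψ x * hg x

theorem toLp_directionalHermite_mem_hermiteEigenspace {η : RSpace n} (hη : ‖η‖ ^ 2 = 2) (k : ℕ) :
    (directionalHermite η k).toLp 2 (volume : Measure (RSpace n)) ∈ hermiteEigenspace n k :=
  toLp_mem_hermiteEigenspace fun x => by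
    rw [laplacian_directionalHermite hη, finrank_euclideanSpace_fin]
    ring

theorem norm_inner_le_norm_hermiteProj_mul {k : ℕ} {g : L2Space n}
    (hg : g ∈ hermiteEigenspace n k) (f : L2Space n) :
    ‖inner ℂ g f‖ ≤ ‖hermiteProj n k f‖ * ‖g‖ := by
  have hproj : inner ℂ g f = inner ℂ g (hermiteProj n k f) := by
    rw [hermiteProj, ← Submodule.inner_starProjection_left_eq_right,
      Submodule.starProjection_eq_self_iff.2 hg]
  rw [hproj, mul_comm]
  exact norm_inner_le_norm _ _

theorem norm_integral_mul_directionalHermite_le (f : L2Space n) {η : RSpace n}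
    (hη : ‖η‖ ^ 2 = 2) (k : ℕ) :
    ‖∫ x, f x * directionalHermite η k x‖ ≤
      ‖hermiteProj n k f‖ * √(π ^ (n / 2 : ℝ) * k.factorial) := by
  set g := (directionalHermite η k).toLp 2 (volume : Measure (RSpace n)) with hg
  have hinner : ∫ x, f x * directionalHermite η k x = inner ℂ g f := by
    rw [L2.inner_def]
    refine integral_congr_ae ?_
    filter_upwards [(directionalHermite η k).coeFn_toLp 2 (volume : Measure (RSpace n))] with x hx
    rw [hg, hx, RCLike.inner_apply, directionalHermite_apply, Complex.conj_ofReal]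
  have hnorm : ‖g‖ = √(π ^ (n / 2 : ℝ) * k.factorial) := by
    rw [hg, norm_toLp_directionalHermite hη, finrank_euclideanSpace_fin]
  rw [hinner, ← hnorm]
  exact norm_inner_le_norm_hermiteProj_mul
    (toLp_directionalHermite_mem_hermiteEigenspace hη k) f

end

end HermiteFunctions

section Bargmann

open scoped Real ENNReal

theorem integral_norm_mul_le_eLpNorm_two_mul_eLpNorm_two {α : Type*} [MeasurableSpace α]
    {μ : Measure α} {f g : α → ℂ} (hf : MemLp f 2 μ) (hg : MemLp g 2 μ) :
    ∫ x, ‖f x * g x‖ ∂μ ≤ (eLpNorm f 2 μ).toReal * (eLpNorm g 2 μ).toReal := by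
  have hint : Integrable (fun x => f x * g x) μ := hf.integrable_mul hg
  have hHolder := eLpNorm_smul_le_mul_eLpNorm (p := 2) (q := 2) (r := 1) hg.1 hf.1
  rw [integral_norm_eq_lintegral_enorm hint.1, ← ENNReal.toReal_mul,
    ← eLpNorm_one_eq_lintegral_enorm]
  exact ENNReal.toReal_mono (ENNReal.mul_ne_top hf.2.ne hg.2.ne) hHolder

theorem pow_div_sqrt_factorial_le (c : ℝ) (k : ℕ) :
    c ^ k / √(k.factorial) ≤ Real.exp (2 * c ^ 2) * (1 / 2) ^ k := by
  have hsq : ((2 * c) ^ 2) ^ k / k.factorial ≤ Real.exp ((2 * c) ^ 2) :=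
    Real.pow_div_factorial_le_exp _ (sq_nonneg _) k
  have hroot : (2 * c) ^ k / √(k.factorial) ≤ Real.exp (2 * c ^ 2) := by
    refine le_of_sq_le_sq ?_ (Real.exp_nonneg _)
    rw [div_pow, Real.sq_sqrt (by positivity), ← Real.exp_nat_mul, ← pow_mul, mul_comm k, pow_mul]
    refine hsq.trans (le_of_eq ?_)
    congr 1
    push_cast
    ring
  calc c ^ k / √(k.factorial) = (2 * c) ^ k / √(k.factorial) * (1 / 2) ^ k := by
        rw [mul_pow, div_mul_eq_mul_div, mul_right_comm, ← mul_pow]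
        norm_num
    _ ≤ Real.exp (2 * c ^ 2) * (1 / 2) ^ k := by gcongr

/-- The function `r ↦ π ^ (n / 4) (√2 r) ^ k / √(k!)`: the `k`-th Taylor term of
`bargmannLine f ω` at `τ` is at most `bargmannWeight n k ‖τ‖` times the norm of the `k`-th Hermite
projection of `f`. -/
def bargmannWeight (n k : ℕ) (r : ℝ) : ℝ :=
  √(π ^ (n / 2 : ℝ)) * ((√2 * r) ^ k / √(k.factorial))

theorem bargmannWeight_nonneg (n k : ℕ) {r : ℝ} (hr : 0 ≤ r) : 0 ≤ bargmannWeight n k r := by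
  unfold bargmannWeight
  positivity

theorem continuous_bargmannWeight (n k : ℕ) : Continuous (bargmannWeight n k) := by
  unfold bargmannWeight
  fun_prop

theorem pow_div_factorial_mul_sqrt_eq_bargmannWeight (n k : ℕ) (r : ℝ) :
    (√2 * r) ^ k / k.factorial * √(π ^ (n / 2 : ℝ) * k.factorial) = bargmannWeight n k r := by
  rw [bargmannWeight, Real.sqrt_mul (by positivity), div_mul_eq_mul_div, mul_left_comm,
    mul_div_assoc, mul_div_assoc, Real.sqrt_div_self', mul_one_div]

theorem bargmannWeight_le (n k : ℕ) {r R : ℝ} (hr : 0 ≤ r) (hR : r ≤ R) :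
    bargmannWeight n k r ≤ √(π ^ (n / 2 : ℝ)) * Real.exp (4 * R ^ 2) * (1 / 2) ^ k := by
  have h := pow_div_sqrt_factorial_le (√2 * R) k
  rw [mul_pow √2 R 2, Real.sq_sqrt zero_le_two, ← mul_assoc, show (2 : ℝ) * 2 = 4 by norm_num] at h
  rw [bargmannWeight, mul_assoc]
  gcongr
  refine le_trans ?_ h
  gcongr

variable {n : ℕ} (f : L2Space n) (ω : RSpace n)

/-- The Bargmann transform of `f` restricted to the complex line spanned by `ω`, rescaled so that
for real `τ` its integrand is `f(x) exp (‖x‖ ^ 2 / 2) exp (-‖x - τ ω‖ ^ 2)` when `‖ω‖ = 1`. -/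
def bargmannLine (τ : ℂ) : ℂ :=
  ∫ x : RSpace n, f x * ((Real.exp (-‖x‖ ^ 2 / 2) : ℝ) : ℂ) *
    Complex.exp (2 * (inner ℝ ω x : ℝ) * τ - τ ^ 2)

/-- The `k`-th Taylor term at `0` of `bargmannLine f ω`. -/
def bargmannTerm (k : ℕ) (τ : ℂ) : ℂ :=
  (√2 * τ) ^ k / k.factorial * ∫ x, f x * directionalHermite (√2 • ω) k x

/-- The majorant of `bargmannLine f ω` on the circle of radius `r`, for all unit vectors `ω`
simultaneously. -/
def bargmannMajorant (r : ℝ) : ℝ≥0∞ :=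
  ∑' k, ENNReal.ofReal (‖hermiteProj n k f‖ * bargmannWeight n k r)

theorem norm_hermiteProj_le (k : ℕ) : ‖hermiteProj n k f‖ ≤ ‖f‖ :=
  Submodule.norm_starProjection_apply_le _ _

theorem summable_mul_one_half_pow (a : ℝ) : Summable fun k : ℕ => a * (1 / 2 : ℝ) ^ k :=
  summable_geometric_two.mul_left a

theorem hasSum_directionalHermite_mul (τ : ℂ) (x : RSpace n) :
    HasSum (fun k : ℕ => (√2 * τ) ^ k / k.factorial * directionalHermite (√2 • ω) k x)
      ((Real.exp (-‖x‖ ^ 2 / 2) : ℝ) * Complex.exp (2 * (inner ℝ ω x : ℝ) * τ - τ ^ 2)) := by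
  have hsqrt : (√2 : ℂ) * √2 = 2 := by
    rw [← Complex.ofReal_mul, Real.mul_self_sqrt zero_le_two, Complex.ofReal_ofNat]
  have hexp : ((√2 * inner ℝ ω x : ℝ) : ℂ) * (√2 * τ) - (√2 * τ) ^ 2 / 2 =
      2 * (inner ℝ ω x : ℝ) * τ - τ ^ 2 := by
    push_cast
    linear_combination (inner ℝ ω x * τ - τ ^ 2 / 2) * hsqrt
  have h := (hasSum_hermite_generating_function ((√2 * inner ℝ ω x : ℝ) : ℂ) (√2 * τ)).mul_left
    ((Real.exp (-‖x‖ ^ 2 / 2) : ℝ) : ℂ)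
  rw [hexp] at h
  refine h.congr_fun fun k => ?_
  rw [directionalHermite_apply, real_inner_smul_left, Complex.ofReal_mul,
    ← Complex.coe_algebraMap, ← Polynomial.aeval_algebraMap_apply, Complex.coe_algebraMap]
  ring

variable {ω} (hω : ‖ω‖ = 1)

include hω

theorem norm_sqrt_two_smul_sq : ‖√2 • ω‖ ^ 2 = 2 := by
  rw [norm_smul, hω, mul_one, Real.norm_of_nonneg (Real.sqrt_nonneg 2), Real.sq_sqrt zero_le_two]

theorem integral_norm_mul_directionalHermite_le (k : ℕ) :
    ∫ x, ‖f x * directionalHermite (√2 • ω) k x‖ ≤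
      ‖f‖ * √(π ^ (n / 2 : ℝ) * k.factorial) := by
  have h := integral_norm_mul_le_eLpNorm_two_mul_eLpNorm_two (Lp.memLp f)
    ((directionalHermite (√2 • ω) k).memLp 2 (volume : Measure (RSpace n)))
  rwa [← Lp.norm_def, ← SchwartzMap.norm_toLp,
    norm_toLp_directionalHermite (norm_sqrt_two_smul_sq hω), finrank_euclideanSpace_fin] at h

theorem hasSum_bargmannTerm (τ : ℂ) :
    HasSum (fun k => bargmannTerm f ω k τ) (bargmannLine f ω τ) := by
  let F (k : ℕ) (x : RSpace n) : ℂ :=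
    (√2 * τ) ^ k / k.factorial * (f x * directionalHermite (√2 • ω) k x)
  have hF (k : ℕ) : Integrable (F k) := ((Lp.memLp f).integrable_mul
    ((directionalHermite (√2 • ω) k).memLp 2 (volume : Measure (RSpace n)))).const_mul _
  have hbound (k : ℕ) : ∫ x, ‖F k x‖ ≤
      ‖f‖ * (√(π ^ (n / 2 : ℝ)) * Real.exp (4 * ‖τ‖ ^ 2)) * (1 / 2) ^ k := by
    calc ∫ x, ‖F k x‖
        = (√2 * ‖τ‖) ^ k / k.factorial * ∫ x, ‖f x * directionalHermite (√2 • ω) k x‖ := by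
          rw [← integral_const_mul]
          simp [F, abs_of_nonneg (Real.sqrt_nonneg 2)]
      _ ≤ (√2 * ‖τ‖) ^ k / k.factorial * (‖f‖ * √(π ^ (n / 2 : ℝ) * k.factorial)) := by
          gcongr
          exact integral_norm_mul_directionalHermite_le f hω k
      _ = ‖f‖ * bargmannWeight n k ‖τ‖ := by
          rw [mul_left_comm, pow_div_factorial_mul_sqrt_eq_bargmannWeight]
      _ ≤ _ := by
          rw [mul_assoc]
          gcongr
          exact bargmannWeight_le n k (norm_nonneg τ) le_rfl
  have hsummable : Summable fun k => ∫ x, ‖F k x‖ :=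
    Summable.of_nonneg_of_le (fun k => by positivity) hbound (summable_mul_one_half_pow _)
  have h := hasSum_integral_of_summable_integral_norm hF hsummable
  have hlimit : ∫ x, ∑' k, F k x = bargmannLine f ω τ := by
    refine integral_congr_ae (ae_of_all _ fun x => ?_)
    simp only [F, mul_left_comm _ (f x), mul_assoc (f x)]
    exact ((hasSum_directionalHermite_mul ω τ x).mul_left (f x)).tsum_eq
  rw [hlimit] at h
  exact h.congr_fun fun k => (integral_const_mul _ _).symm

theorem norm_bargmannTerm_le (k : ℕ) (τ : ℂ) :
    ‖bargmannTerm f ω k τ‖ ≤ ‖hermiteProj n k f‖ * bargmannWeight n k ‖τ‖ := by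
  rw [← pow_div_factorial_mul_sqrt_eq_bargmannWeight, mul_left_comm, bargmannTerm, norm_mul,
    norm_div, norm_pow, norm_mul, Complex.norm_natCast, Complex.norm_real,
    Real.norm_of_nonneg (Real.sqrt_nonneg 2)]
  gcongr
  exact norm_integral_mul_directionalHermite_le f (norm_sqrt_two_smul_sq hω) k

theorem enorm_bargmannLine_le (τ : ℂ) : ‖bargmannLine f ω τ‖ₑ ≤ bargmannMajorant f ‖τ‖ := by
  rw [← (hasSum_bargmannTerm f hω τ).tsum_eq]
  refine enorm_tsum_le_tsum_enorm.trans (ENNReal.tsum_le_tsum fun k => ?_)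
  rw [← ofReal_norm]
  exact ENNReal.ofReal_le_ofReal (norm_bargmannTerm_le f hω k τ)

omit hω

theorem hermiteProj_mul_bargmannWeight_le (k : ℕ) {r R : ℝ} (hr : 0 ≤ r) (hR : r ≤ R) :
    ‖hermiteProj n k f‖ * bargmannWeight n k r ≤
      ‖f‖ * √(π ^ (n / 2 : ℝ)) * Real.exp (4 * R ^ 2) * (1 / 2) ^ k := by
  refine (mul_le_mul (norm_hermiteProj_le f k) (bargmannWeight_le n k hr hR)
    (bargmannWeight_nonneg n k hr) (norm_nonneg f)).trans (le_of_eq ?_)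
  ring

theorem bargmannMajorant_le {r R : ℝ} (hr : 0 ≤ r) (hR : r ≤ R) :
    bargmannMajorant f r ≤
      ENNReal.ofReal (‖f‖ * √(π ^ (n / 2 : ℝ)) * Real.exp (4 * R ^ 2) * 2) := by
  have h := hasSum_geometric_two.mul_left (‖f‖ * √(π ^ (n / 2 : ℝ)) * Real.exp (4 * R ^ 2))
  rw [← h.tsum_eq, ENNReal.ofReal_tsum_of_nonneg (fun k => by positivity) h.summable]
  exact ENNReal.tsum_le_tsum fun k =>
    ENNReal.ofReal_le_ofReal (hermiteProj_mul_bargmannWeight_le f k hr hR)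

theorem measurable_bargmannMajorant : Measurable (bargmannMajorant f) :=
  Measurable.tsum fun k =>
    ((continuous_bargmannWeight n k).measurable.const_mul _).ennreal_ofReal

include hω

theorem hasGaussianGrowth_bargmannLine : HasGaussianGrowth (bargmannLine f ω) := by
  refine ⟨‖f‖ * √(π ^ (n / 2 : ℝ)) * 2, 4, by norm_num, fun τ => ?_⟩
  have h := (enorm_bargmannLine_le f hω τ).trans
    (bargmannMajorant_le f (norm_nonneg τ) le_rfl)
  rw [← ofReal_norm, mul_right_comm _ _ (2 : ℝ)] at h
  exact (ENNReal.ofReal_le_ofReal_iff (by positivity)).1 h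

theorem differentiable_bargmannLine : Differentiable ℂ (bargmannLine f ω) := by
  have hseries : bargmannLine f ω = fun τ => ∑' k, bargmannTerm f ω k τ :=
    funext fun τ => (hasSum_bargmannTerm f hω τ).tsum_eq.symm
  have hterm (k : ℕ) : Differentiable ℂ (bargmannTerm f ω k) := by
    unfold bargmannTerm
    fun_prop
  rw [hseries]
  intro τ
  have hball : DifferentiableOn ℂ (fun τ => ∑' k, bargmannTerm f ω k τ)
      (Metric.ball 0 (‖τ‖ + 1)) :=
    Complex.differentiableOn_tsum_of_summable_norm
      (summable_mul_one_half_pow (‖f‖ * √(π ^ (n / 2 : ℝ)) * Real.exp (4 * (‖τ‖ + 1) ^ 2)))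
      (fun k => (hterm k).differentiableOn) Metric.isOpen_ball fun k w hw =>
        (norm_bargmannTerm_le f hω k w).trans
          (hermiteProj_mul_bargmannWeight_le f k (norm_nonneg w) (mem_ball_zero_iff.1 hw).le)
  exact hball.differentiableAt (Metric.isOpen_ball.mem_nhds (by simp))

end Bargmann

section GaussianConvolution

open scoped Real ENNReal

theorem le_ofReal_sqrt_of_sq_le_ofReal {x : ℝ≥0∞} {b : ℝ} (hb : 0 ≤ b)
    (h : x ^ 2 ≤ ENNReal.ofReal b) : x ≤ ENNReal.ofReal √b := by
  rw [← Real.sq_sqrt hb, ENNReal.ofReal_pow (Real.sqrt_nonneg b)] at h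
  exact (ENNReal.pow_le_pow_left_iff two_ne_zero).1 h

variable {n : ℕ} (f : L2Space n)

/-- The convolution of `|f| exp (‖x‖ ^ 2 / 2)` with the Gaussian `exp (-‖x‖ ^ 2)`; it dominates the
Bargmann transform of `f` at real points. -/
def gaussianConv (u : RSpace n) : ℝ≥0∞ :=
  ∫⁻ x, ‖f x‖ₑ * ENNReal.ofReal (Real.exp (‖x‖ ^ 2 / 2) * Real.exp (-‖u - x‖ ^ 2))

theorem measurable_gaussianConv_kernel : Measurable (Function.uncurry fun u x : RSpace n =>
    ‖f x‖ₑ * ENNReal.ofReal (Real.exp (‖x‖ ^ 2 / 2) * Real.exp (-‖u - x‖ ^ 2))) :=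
  ((Lp.stronglyMeasurable f).measurable.comp measurable_snd).enorm.mul
    (Continuous.measurable (by fun_prop)).ennreal_ofReal

theorem measurable_gaussianConv : Measurable (gaussianConv f) :=
  (measurable_gaussianConv_kernel f).lintegral_prod_right'

theorem enorm_bargmannLine_ofReal_le {ω : RSpace n} (hω : ‖ω‖ = 1) (r : ℝ) :
    ‖bargmannLine f ω r‖ₑ ≤ gaussianConv f (r • ω) := by
  refine (enorm_integral_le_lintegral_enorm _).trans (le_of_eq (lintegral_congr fun x => ?_))
  have hreal : Complex.exp (2 * (inner ℝ ω x : ℝ) * r - (r : ℂ) ^ 2) =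
      ((Real.exp (2 * inner ℝ ω x * r - r ^ 2) : ℝ) : ℂ) := by
    push_cast
    rfl
  have hsquare : -‖x‖ ^ 2 / 2 + (2 * inner ℝ ω x * r - r ^ 2) =
      ‖x‖ ^ 2 / 2 + -‖r • ω - x‖ ^ 2 := by
    rw [norm_sub_sq_real, real_inner_smul_left, norm_smul, hω, mul_one, Real.norm_eq_abs, sq_abs]
    ring
  rw [hreal, mul_assoc, ← Complex.ofReal_mul, enorm_mul, ← Real.exp_add, ← Real.exp_add, hsquare,
    ← ofReal_norm (Complex.ofReal _), Complex.norm_real, Real.norm_of_nonneg (Real.exp_nonneg _)]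

theorem measurable_ofReal_mul_bargmannWeight_norm (p : ℝ) (k : ℕ) :
    Measurable fun u : RSpace n => ENNReal.ofReal (p * bargmannWeight n k ‖u‖) :=
  (((continuous_bargmannWeight n k).comp continuous_norm).measurable.const_mul p).ennreal_ofReal

theorem lintegral_gaussian_mul_bargmannWeight_le {a : ℕ} (ha : n = a + 1) (k : ℕ) (x : RSpace n) :
    ∫⁻ u, ENNReal.ofReal (Real.exp (‖x‖ ^ 2 / 2) * Real.exp (-‖u - x‖ ^ 2) *
        bargmannWeight n k ‖u‖) ≤
      ENNReal.ofReal (√(π ^ (n / 2 : ℝ)) * √(π ^ n) * √(laguerreFun a k (twoI x)).re) := by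
  have hL : 0 ≤ laguerreNeg a k (2 * ‖x‖ ^ 2) := laguerreNeg_nonneg a k (by positivity)
  have hmoment := le_ofReal_sqrt_of_sq_le_ofReal (by positivity)
    (sq_lintegral_pow_norm_mul_gaussian_le (V := RSpace n)
      (finrank_euclideanSpace_fin.trans ha) k x)
  set c : ℝ := Real.exp (‖x‖ ^ 2 / 2) * √(π ^ (n / 2 : ℝ)) / √(k.factorial) with hc
  calc ∫⁻ u, ENNReal.ofReal (Real.exp (‖x‖ ^ 2 / 2) * Real.exp (-‖u - x‖ ^ 2) *
        bargmannWeight n k ‖u‖)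
      = ENNReal.ofReal c *
          ∫⁻ u, ENNReal.ofReal ((√2 * ‖u‖) ^ k * Real.exp (-‖u - x‖ ^ 2)) := by
        rw [← lintegral_const_mul' _ _ ENNReal.ofReal_ne_top]
        refine lintegral_congr fun u => ?_
        rw [← ENNReal.ofReal_mul (by positivity), bargmannWeight, hc]
        congr 1
        ring
    _ ≤ ENNReal.ofReal c *
          ENNReal.ofReal √(π ^ (a + 1) * k.factorial * laguerreNeg a k (2 * ‖x‖ ^ 2)) := by
        gcongr
    _ = _ := by
        rw [← ENNReal.ofReal_mul (by positivity), re_laguerreFun_twoI, Real.sqrt_mul hL,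
          Real.sqrt_mul (by positivity), Real.sqrt_mul (by positivity), ← ha, ← Real.exp_half, hc]
        have : √(k.factorial : ℝ) ≠ 0 := (Real.sqrt_pos.2 (by positivity)).ne'
        congr 1
        field_simp

theorem lintegral_gaussianConv_mul_bargmannWeight_le {a : ℕ} (ha : n = a + 1) {p : ℝ} (hp : 0 ≤ p)
    (k : ℕ) :
    ∫⁻ u, gaussianConv f u * ENNReal.ofReal (p * bargmannWeight n k ‖u‖) ≤
      ENNReal.ofReal (√(π ^ (n / 2 : ℝ)) * √(π ^ n)) *
        ∫⁻ x, ENNReal.ofReal (‖f x‖ * p * √(laguerreFun a k (twoI x)).re) := by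
  simp only [gaussianConv, ← lintegral_mul_const' _ _ ENNReal.ofReal_ne_top]
  rw [lintegral_lintegral_swap ((measurable_gaussianConv_kernel f).mul
      ((measurable_ofReal_mul_bargmannWeight_norm p k).comp measurable_fst)).aemeasurable,
    ← lintegral_const_mul' _ _ ENNReal.ofReal_ne_top]
  refine lintegral_mono fun x => ?_
  calc ∫⁻ u, ‖f x‖ₑ * ENNReal.ofReal (Real.exp (‖x‖ ^ 2 / 2) * Real.exp (-‖u - x‖ ^ 2)) *
          ENNReal.ofReal (p * bargmannWeight n k ‖u‖)
      = ENNReal.ofReal (‖f x‖ * p) * ∫⁻ u, ENNReal.ofReal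
          (Real.exp (‖x‖ ^ 2 / 2) * Real.exp (-‖u - x‖ ^ 2) * bargmannWeight n k ‖u‖) := by
        rw [← lintegral_const_mul' _ _ ENNReal.ofReal_ne_top]
        refine lintegral_congr fun u => ?_
        rw [← ofReal_norm, ← ENNReal.ofReal_mul (by positivity), ← ENNReal.ofReal_mul
          (by positivity), ← ENNReal.ofReal_mul (by positivity)]
        congr 1
        ring
    _ ≤ ENNReal.ofReal (‖f x‖ * p) * ENNReal.ofReal
          (√(π ^ (n / 2 : ℝ)) * √(π ^ n) * √(laguerreFun a k (twoI x)).re) := by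
        gcongr
        exact lintegral_gaussian_mul_bargmannWeight_le ha k x
    _ = _ := by
        rw [← ENNReal.ofReal_mul (by positivity), ← ENNReal.ofReal_mul (by positivity)]
        congr 1
        ring

theorem lintegral_gaussianConv_mul_bargmannMajorant_ne_top {a : ℕ} (ha : n = a + 1)
    (h : ∑' k : ℕ, ∫⁻ y : RSpace n, ENNReal.ofReal
      (‖f y‖ * ‖hermiteProj n k f‖ * √(laguerreFun a k (twoI y)).re) ≠ ⊤) :
    ∫⁻ u, gaussianConv f u * bargmannMajorant f ‖u‖ ≠ ⊤ := by
  have hmeas (k : ℕ) : Measurable fun u : RSpace n =>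
      gaussianConv f u * ENNReal.ofReal (‖hermiteProj n k f‖ * bargmannWeight n k ‖u‖) :=
    (measurable_gaussianConv f).mul (measurable_ofReal_mul_bargmannWeight_norm _ k)
  simp only [bargmannMajorant, ← ENNReal.tsum_mul_left]
  rw [lintegral_tsum fun k => (hmeas k).aemeasurable]
  refine ne_top_of_le_ne_top ?_ (ENNReal.tsum_le_tsum fun k =>
    lintegral_gaussianConv_mul_bargmannWeight_le f ha (norm_nonneg _) k)
  rw [ENNReal.tsum_mul_left]
  exact ENNReal.mul_ne_top ENNReal.ofReal_ne_top h

end GaussianConvolution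

section PolarCoordinates

open Set
open scoped ENNReal

variable {E : Type*} [NormedAddCommGroup E] [NormedSpace ℝ E] [Nontrivial E]
  [FiniteDimensional ℝ E] [MeasurableSpace E] [BorelSpace E] (μ : Measure E)
  [μ.IsAddHaarMeasure] {h : E → ℝ≥0∞}

theorem lintegral_eq_lintegral_sphere_lintegral_Ioi (hh : Measurable h) :
    ∫⁻ x, h x ∂μ = ∫⁻ ω : Metric.sphere (0 : E) 1, (∫⁻ r in Ioi (0 : ℝ),
      ENNReal.ofReal (r ^ (Module.finrank ℝ E - 1)) * h (r • (ω : E))) ∂μ.toSphere := by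
  have hpolar : Measurable fun p : Metric.sphere (0 : E) 1 × Ioi (0 : ℝ) =>
      h ((p.2 : ℝ) • (p.1 : E)) :=
    hh.comp (Continuous.measurable (by fun_prop))
  have hprod : ∫⁻ x, h x ∂μ = ∫⁻ p : Metric.sphere (0 : E) 1 × Ioi (0 : ℝ),
      h ((p.2 : ℝ) • (p.1 : E))
        ∂(μ.toSphere.prod (Measure.volumeIoiPow (Module.finrank ℝ E - 1))) := by
    rw [← μ.measurePreserving_homeomorphUnitSphereProd.lintegral_comp hpolar,
      ← restrict_compl_singleton (μ := μ) (0 : E),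
      ← lintegral_subtype_comap (measurableSet_singleton (0 : E)).compl, restrict_compl_singleton]
    refine lintegral_congr fun x => ?_
    have hx : ‖(x : E)‖ ≠ 0 := norm_ne_zero_iff.2 x.2
    congr 1
    simp [smul_smul, hx]
  rw [hprod, lintegral_prod _ hpolar.aemeasurable]
  refine lintegral_congr fun ω => ?_
  have hray : Measurable fun r : Ioi (0 : ℝ) => h ((r : ℝ) • (ω : E)) :=
    hh.comp (Continuous.measurable (by fun_prop))
  rw [Measure.volumeIoiPow, lintegral_withDensity_eq_lintegral_mul _
    (Continuous.measurable (by fun_prop)).ennreal_ofReal hray]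
  exact lintegral_subtype_comap measurableSet_Ioi
    fun r : ℝ => ENNReal.ofReal (r ^ (Module.finrank ℝ E - 1)) * h (r • (ω : E))

theorem ae_lintegral_Ioi_pow_mul_ne_top (hh : Measurable h) (hfin : ∫⁻ x, h x ∂μ ≠ ⊤) :
    ∀ᵐ ω : Metric.sphere (0 : E) 1 ∂μ.toSphere, ∫⁻ r in Ioi (0 : ℝ),
      ENNReal.ofReal (r ^ (Module.finrank ℝ E - 1)) * h (r • (ω : E)) ≠ ⊤ := by
  rw [lintegral_eq_lintegral_sphere_lintegral_Ioi μ hh] at hfin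
  have hmeas : Measurable fun p : Metric.sphere (0 : E) 1 × ℝ =>
      ENNReal.ofReal (p.2 ^ (Module.finrank ℝ E - 1)) * h (p.2 • (p.1 : E)) :=
    (Continuous.measurable (by fun_prop)).ennreal_ofReal.mul
      (hh.comp (Continuous.measurable (by fun_prop)))
  filter_upwards [ae_lt_top hmeas.lintegral_prod_right' hfin] with ω hω using hω.ne

theorem ae_eq_zero_of_ae_sphere_eq_zero {F : Type*} [NormedAddCommGroup F] [MeasurableSpace F]
    [OpensMeasurableSpace F] {g : E → F} (hg : Measurable g)
    (h0 : ∀ᵐ ω : Metric.sphere (0 : E) 1 ∂μ.toSphere, ∀ r : ℝ, g (r • (ω : E)) = 0) :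
    ∀ᵐ x ∂μ, g x = 0 := by
  have hzero : ∫⁻ x, ‖g x‖ₑ ∂μ = 0 := by
    rw [lintegral_eq_lintegral_sphere_lintegral_Ioi μ hg.enorm]
    refine (lintegral_congr_ae ?_).trans lintegral_zero
    filter_upwards [h0] with ω hω
    simp only [hω, enorm_zero, mul_zero, lintegral_zero]
  filter_upwards [(lintegral_eq_zero_iff hg.enorm).1 hzero] with x hx using enorm_eq_zero.1 hx

theorem lintegral_Ioi_ne_top_of_pow_mul {g : ℝ → ℝ≥0∞} {M : ℝ≥0∞} (hM : M ≠ ⊤)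
    (hg : ∀ r ∈ Ioc (0 : ℝ) 1, g r ≤ M) (d : ℕ)
    (hfin : ∫⁻ r in Ioi (0 : ℝ), ENNReal.ofReal (r ^ d) * g r ≠ ⊤) :
    ∫⁻ r in Ioi (0 : ℝ), g r ≠ ⊤ := by
  rw [← Ioc_union_Ioi_eq_Ioi zero_le_one,
    lintegral_union measurableSet_Ioi (Ioc_disjoint_Ioi le_rfl)]
  refine ENNReal.add_ne_top.2 ⟨ne_top_of_le_ne_top hM ?_, ne_top_of_le_ne_top hfin ?_⟩
  · calc ∫⁻ r in Ioc (0 : ℝ) 1, g r ≤ ∫⁻ _ in Ioc (0 : ℝ) 1, M :=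
          setLIntegral_mono' measurableSet_Ioc hg
      _ = M := by simp
  · calc ∫⁻ r in Ioi (1 : ℝ), g r ≤ ∫⁻ r in Ioi (1 : ℝ), ENNReal.ofReal (r ^ d) * g r :=
          setLIntegral_mono' measurableSet_Ioi fun r hr =>
            le_mul_of_one_le_left' (ENNReal.one_le_ofReal.2 (one_le_pow₀ hr.le))
      _ ≤ _ := lintegral_mono_set (Ioi_subset_Ioi zero_le_one)

end PolarCoordinates

section BeurlingHermite

open Set
open scoped Real ENNReal FourierTransform

theorem ae_eq_zero_of_fourier_ae_eq_zero {V : Type*} [NormedAddCommGroup V] [InnerProductSpace ℝ V]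
    [FiniteDimensional ℝ V] [MeasurableSpace V] [BorelSpace V] {h : V → ℂ} (hh : Integrable h)
    (h0 : ∀ᵐ v : V, 𝓕 h v = 0) : ∀ᵐ x, h x = 0 := by
  refine ae_eq_zero_of_integral_contDiff_smul_eq_zero hh.locallyIntegrable fun g hg hs => ?_
  have hsupport : HasCompactSupport (Complex.ofRealCLM ∘ g) := hs.comp_left rfl
  have hsmooth : ContDiff ℝ ((⊤ : ℕ∞) : WithTop ℕ∞) (Complex.ofRealCLM ∘ g) := by fun_prop
  let ψ : 𝓢(V, ℂ) := hsupport.toSchwartzMap hsmooth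
  let χ : 𝓢(V, ℂ) := 𝓕⁻ ψ
  have hχ : 𝓕 χ = ψ := FourierTransform.fourier_fourierInv_eq ψ
  have hflip : ∫ ξ, 𝓕 h ξ * χ ξ = ∫ x, h x * (𝓕 (χ : V → ℂ)) x := by
    simpa using! (VectorFourier.integral_fourierIntegral_smul_eq_flip (L := innerₗ V)
      Real.continuous_fourierChar continuous_inner hh χ.integrable)
  rw [← SchwartzMap.fourier_coe, hχ] at hflip
  calc ∫ x, g x • h x = ∫ x, h x * ψ x := by
        refine integral_congr_ae (ae_of_all _ fun x => ?_)
        change g x • h x = h x * (g x : ℂ)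
        rw [Complex.real_smul, mul_comm]
    _ = ∫ ξ, 𝓕 h ξ * χ ξ := hflip.symm
    _ = 0 := by
        refine integral_eq_zero_of_ae ?_
        filter_upwards [h0] with v hv
        simp [hv]

variable {n : ℕ} {f : L2Space n}

theorem fourier_mul_gaussianSchwartz_smul (f : L2Space n) (ω : RSpace n) (r : ℝ) :
    𝓕 (fun x => f x * gaussianSchwartz (RSpace n) x) (r • ω) =
      Complex.exp ((-(π * r) * Complex.I) ^ 2) * bargmannLine f ω (-(π * r) * Complex.I) := by
  rw [Real.fourier_eq', bargmannLine, ← integral_const_mul]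
  refine integral_congr_ae (ae_of_all _ fun x => ?_)
  have := Complex.exp_ne_zero ((-(π * r) * Complex.I) ^ 2)
  simp only [gaussianSchwartz_apply, smul_eq_mul]
  rw [Complex.exp_sub, inner_smul_right, real_inner_comm]
  field_simp
  rw [mul_comm (Complex.exp _)]
  congr 2
  push_cast
  ring

theorem eq_zero_of_ae_bargmannLine_eq_zero [Nontrivial (RSpace n)]
    (h : ∀ᵐ ω : Metric.sphere (0 : RSpace n) 1 ∂(volume : Measure (RSpace n)).toSphere,
      ∀ τ, bargmannLine f ω τ = 0) : f = 0 := by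
  have hint : Integrable fun x => f x * gaussianSchwartz (RSpace n) x :=
    (Lp.memLp f).integrable_mul ((gaussianSchwartz (RSpace n)).memLp 2 volume)
  have hcont : Continuous (𝓕 fun x => f x * gaussianSchwartz (RSpace n) x) :=
    VectorFourier.fourierIntegral_continuous Real.continuous_fourierChar continuous_inner hint
  have hfourier : ∀ᵐ v, 𝓕 (fun x => f x * gaussianSchwartz (RSpace n) x) v = 0 := by
    refine ae_eq_zero_of_ae_sphere_eq_zero volume hcont.measurable ?_
    filter_upwards [h] with ω hω r
    rw [fourier_mul_gaussianSchwartz_smul, hω, mul_zero]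
  rw [Lp.eq_zero_iff_ae_eq_zero]
  filter_upwards [ae_eq_zero_of_fourier_ae_eq_zero hint hfourier] with x hx
  refine (mul_eq_zero.1 hx).resolve_right ?_
  rw [gaussianSchwartz_apply]
  exact Complex.ofReal_ne_zero.2 (Real.exp_pos _).ne'

theorem bargmannLine_eq_zero_of_lintegral_ne_top {ω : RSpace n} (hω : ‖ω‖ = 1) (d : ℕ)
    (hfin : ∫⁻ r in Ioi (0 : ℝ), ENNReal.ofReal (r ^ d) *
      ((gaussianConv f (r • ω) + gaussianConv f (-(r • ω))) * bargmannMajorant f ‖r • ω‖) ≠ ⊤)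
    (τ : ℂ) : bargmannLine f ω τ = 0 := by
  set M := ENNReal.ofReal (‖f‖ * √(π ^ (n / 2 : ℝ)) * Real.exp (4 * 1 ^ 2) * 2)
  have : M ≠ ⊤ := ENNReal.ofReal_ne_top
  refine eq_zero_of_lintegral_mul_majorant_ne_top (differentiable_bargmannLine f hω)
    (hasGaussianGrowth_bargmannLine f hω) (enorm_bargmannLine_le f hω)
    (lintegral_Ioi_ne_top_of_pow_mul (M := (M + M) * M) (by finiteness) ?_ d ?_) τ
  · intro r hr
    have hmajorant : bargmannMajorant f r ≤ M := bargmannMajorant_le f hr.1.le hr.2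
    have hline (s : ℂ) (hs : ‖s‖ = r) : ‖bargmannLine f ω s‖ₑ ≤ M :=
      (enorm_bargmannLine_le f hω s).trans (hs ▸ hmajorant)
    have hnorm : ‖(r : ℂ)‖ = r := Complex.norm_of_nonneg hr.1.le
    gcongr
    · exact hline r hnorm
    · exact hline (-r) (by rw [norm_neg, hnorm])
  · refine ne_top_of_le_ne_top hfin (setLIntegral_mono' measurableSet_Ioi fun r hr => ?_)
    rw [norm_smul, hω, mul_one, Real.norm_of_nonneg (le_of_lt hr)]
    gcongr
    · exact enorm_bargmannLine_ofReal_le f hω r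
    · simpa using enorm_bargmannLine_ofReal_le f hω (-r)

theorem eq_zero_of_lintegral_gaussianConv_mul_bargmannMajorant_ne_top [Nontrivial (RSpace n)]
    (hfin : ∫⁻ u, gaussianConv f u * bargmannMajorant f ‖u‖ ≠ ⊤) : f = 0 := by
  have hconv := measurable_gaussianConv f
  have hmajorant : Measurable fun u : RSpace n => bargmannMajorant f ‖u‖ :=
    (measurable_bargmannMajorant f).comp measurable_norm
  have hprod : Measurable fun u => gaussianConv f u * bargmannMajorant f ‖u‖ :=
    hconv.mul hmajorant
  have hreflect : ∫⁻ u, gaussianConv f (-u) * bargmannMajorant f ‖u‖ =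
      ∫⁻ u, gaussianConv f u * bargmannMajorant f ‖u‖ := by
    simpa only [norm_neg] using lintegral_neg_eq_self (μ := (volume : Measure (RSpace n)))
      (fun u => gaussianConv f u * bargmannMajorant f ‖u‖)
  have hsymm : ∫⁻ u, (gaussianConv f u + gaussianConv f (-u)) * bargmannMajorant f ‖u‖ ≠ ⊤ := by
    simp only [add_mul]
    rw [lintegral_add_left hprod, hreflect]
    exact ENNReal.add_ne_top.2 ⟨hfin, hfin⟩
  refine eq_zero_of_ae_bargmannLine_eq_zero ?_
  filter_upwards [ae_lintegral_Ioi_pow_mul_ne_top volume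
    ((hconv.add (hconv.comp measurable_neg)).mul hmajorant) hsymm] with ω hω
  exact bargmannLine_eq_zero_of_lintegral_ne_top (norm_eq_of_mem_sphere ω) _ hω

end BeurlingHermite

end

theorem mainTheorem5 (n : ℕ) (hn : 1 ≤ n) :
    ¬ ∃ f : L2Space n, f ≠ 0 ∧
      (∑' k : ℕ, ∫⁻ y : RSpace n,
        ENNReal.ofReal
          (‖f y‖ * ‖hermiteProj n k f‖ * √(laguerreFun (n - 1) k (twoI y)).re)) < ⊤ := by
  rintro ⟨f, hf, h⟩
  have : Nontrivial (RSpace n) := Module.nontrivial_of_finrank_pos (R := ℝ) (by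
    rw [finrank_euclideanSpace_fin]; exact hn)
  exact hf (eq_zero_of_lintegral_gaussianConv_mul_bargmannMajorant_ne_top
    (lintegral_gaussianConv_mul_bargmannMajorant_ne_top f (Nat.sub_add_cancel hn).symm h.ne))
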